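/- Let $\mathcal G$ be a connected undirected graph without self-loops on the agents $\mathcal I=\{1,\dots,n\}$, with symmetric edge weights $w_{ij}=w_{ji}>0$. Let $A=[a_{ij}]$ be its weighted adjacency matrix ($a_{ij}=w_{ij}$ if $i,j$ are adjacent, $a_{ij}=0$ otherwise) and $L=\Delta-A$ its Laplacian, where $\Delta$ is the diagonal matrix with $\Delta_{ii}=\sum_j a_{ij}$. Let $k\ge 1$, $p\in[1,\infty]$, $\mathcal I_c\subset\mathcal I$, and let $f_i:\mathbb R^k\to\mathbb R^k$, $i\in\mathcal I$, be functions such that * for $i\in\mathcal I_c$, $f_i$ is locally Lipschitz, $f_i(0)=0$, and $f_i(y)^\top y=\|f_i(y)\|_2\,\|y\|_2>0$ for all $y\ne 0$; * for $i\notin\mathcal I_c$, $f_i$ is the direction-preserving $\ell_p$ signum: $f_i(y)=y/\|y\|_p$ for $y\neq 0$ and $f_i(0)=0$. For $x=(x_1,\dots,x_n)\in\mathbb R^{kn}$ with $x_i\in\mathbb R^k$, consider the closed loop $\dot x=h(x):=f(-(L\otimes I_k)x)$, where $f(y)=(f_1(y_1),\dots,f_n(y_n))$; that is, $\dot x_i=f_i\big(\sum_j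 a_{ij}(x_j-x_i)\big)$. Its Filippov map is $$\mathcal F[h](x)=\bigcap_{\delta>0}\ \bigcap_{\mu(S)=0}\overline{\mathrm{co}}\,\{h(B(x,\delta)\setminus S)\},$$ where $\mu$ is Lebesgue measure, $B(x,\delta)$ is the open Euclidean ball and $\overline{\mathrm{co}}$ is the closed convex hull. A Filippov solution on a time interval $J\subset[0,\infty)$ with $0\in J$ is a function $x:J\to\mathbb R^{kn}$ that is absolutely continuous on $[0,T]$ for every $T\in J$ and satisfies $\dot x(t)\in\mathcal F[h](x(t))$ for almost every $t\in J$. It is maximal if it is not the restriction of a Filippov solution on a strictly larger such interval. Say that all Filippov solutions converge to static consensus in finite time if every maximal Filippov solution is defined on $[0,\infty)$ and there are $t^*>0$ and $\bar x\in\mathbb R^k$ with $x_i(t)=\bar x$ for all $i\in\mathcal I$ and all $t\ge t^*$. Theorem. (i) If $n>2$, then all Filippov solutions converge to static consensus in finite time if and only if $|\mathcal I_c|=1$. (ii) If $n=2$, then all Filippov solutions converge to static consensus in finite time if and only if $|\mathcal I_c|\le 1$. -/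

import Mathlib

open MeasureTheory Set
open scoped ENNReal

namespace FiniteTimeConsensus

/-! ### Filippov solutions -/

section Filippov

variable {E : Type*} [NormedAddCommGroup E] [NormedSpace ℝ E] [MeasureSpace E]

/-- The Filippov set-valued map
`F[g](x) = ⋂_{δ > 0} ⋂_{μ(S) = 0} closure (conv (g (B(x, δ) \ S)))`. -/
def filippovMap (g : E → E) (x : E) : Set E :=
  ⋂ (δ : ℝ) (_ : 0 < δ) (S : Set E) (_ : volume S = 0),
    closure (convexHull ℝ (g '' (Metric.ball x δ \ S)))

/-- `x`, restricted to the time interval `J` (an interval with left end point `0 ∈ J`, closed, half-open or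
unbounded on the right), is a Filippov solution of `ẋ = g(x)`: it is absolutely continuous on every
`[0, T]` with `T ∈ J`, and `ẋ(t) ∈ F[g](x(t))` for almost every `t ∈ J`.
The values of `x` outside `J` play no role. -/
structure IsFilippovSolution (g : E → E) (J : Set ℝ) (x : ℝ → E) : Prop where
  ordConnected : J.OrdConnected
  zero_mem : (0 : ℝ) ∈ J
  nonneg : ∀ t ∈ J, 0 ≤ t
  absolutelyContinuous : ∀ T ∈ J, AbsolutelyContinuousOnInterval x 0 T
  hasDerivAt : ∀ᵐ t : ℝ, t ∈ J → ∃ v ∈ filippovMap g (x t), HasDerivAt x v t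

/-- A Filippov solution is maximal if it is not the truncation of another Filippov solution with
a larger interval of definition. -/
def IsMaximalFilippovSolution (g : E → E) (J : Set ℝ) (x : ℝ → E) : Prop :=
  IsFilippovSolution g J x ∧
    ∀ (J' : Set ℝ) (y : ℝ → E), IsFilippovSolution g J' y → J ⊆ J' → EqOn x y J → J' = J

end Filippov

/-! ### The multi-agent system -/

/-- The weighted adjacency matrix: `a_ij = w_ij` if `i` and `j` are adjacent, `0` otherwise. -/
noncomputable def adjacency {n : ℕ} (G : SimpleGraph (Fin n)) (w : Fin n → Fin n → ℝ) :
    Matrix (Fin n) (Fin n) ℝ :=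
  open Classical in Matrix.of fun i j => if G.Adj i j then w i j else 0

/-- The weighted graph Laplacian `L = Δ - A`, with `Δ` the diagonal matrix of degrees `∑ j, a_ij`. -/
noncomputable def laplacian {n : ℕ} (G : SimpleGraph (Fin n)) (w : Fin n → Fin n → ℝ) :
    Matrix (Fin n) (Fin n) ℝ :=
  Matrix.diagonal (fun i => ∑ j, adjacency G w i j) - adjacency G w

/-- The state space `ℝ^{kn}` with its Euclidean norm and Lebesgue measure: a state `x` consists of `n` blocks
`x i ∈ ℝ^k`, one for each agent. -/
abbrev State (n k : ℕ) : Type := PiLp 2 (fun _ : Fin n => EuclideanSpace ℝ (Fin k))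

/-- The direction-preserving signum: `w / ‖w‖_p` for `w ≠ 0`, and `0` for `w = 0`. -/
noncomputable def dirSign (p : ℝ≥0∞) {k : ℕ} (w : EuclideanSpace ℝ (Fin k)) :
    EuclideanSpace ℝ (Fin k) :=
  open Classical in
  if w = 0 then 0 else (‖WithLp.toLp p (WithLp.ofLp w)‖)⁻¹ • w

/-- A locally Lipschitz direction-preserving feedback. -/
structure IsDirectionPreserving {k : ℕ} (φ : EuclideanSpace ℝ (Fin k) → EuclideanSpace ℝ (Fin k)) :
    Prop where
  locallyLipschitz : LocallyLipschitz φ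
  map_zero : φ 0 = 0
  inner_eq : ∀ y, y ≠ 0 → inner ℝ (φ y) y = ‖φ y‖ * ‖y‖
  inner_pos : ∀ y, y ≠ 0 → 0 < inner ℝ (φ y) y

/-- The agents in `Ic` use locally Lipschitz direction-preserving feedbacks, all the others use the
direction-preserving `ℓ_p` signum. -/
structure IsAdmissible (p : ℝ≥0∞) {n k : ℕ} (Ic : Finset (Fin n))
    (f : Fin n → EuclideanSpace ℝ (Fin k) → EuclideanSpace ℝ (Fin k)) : Prop where
  continuous_agents : ∀ i ∈ Ic, IsDirectionPreserving (f i)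
  signum_agents : ∀ i ∉ Ic, f i = dirSign p

/-- The closed loop vector field `h(x) = f(-(L ⊗ I_k) x)`, `f(y) = (f_1(y_1), …, f_n(y_n))`.
The `i`-th block of `(L ⊗ I_k) x` is `∑ j, L_ij x_j`. -/
noncomputable def closedLoop {n k : ℕ} (G : SimpleGraph (Fin n)) (w : Fin n → Fin n → ℝ)
    (f : Fin n → EuclideanSpace ℝ (Fin k) → EuclideanSpace ℝ (Fin k)) (x : State n k) : State n k :=
  WithLp.toLp 2 fun i => f i (-∑ j, laplacian G w i j • x j)

/-- The closed loop, written agent by agent: `ẋ_i = f_i (∑ j, a_ij (x_j - x_i))`. -/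
theorem closedLoop_apply {n k : ℕ} (G : SimpleGraph (Fin n)) (w : Fin n → Fin n → ℝ)
    (f : Fin n → EuclideanSpace ℝ (Fin k) → EuclideanSpace ℝ (Fin k)) (x : State n k) (i : Fin n) :
    closedLoop G w f x i = f i (∑ j, adjacency G w i j • (x j - x i)) := by
  have h : (-∑ j, laplacian G w i j • x j) = ∑ j, adjacency G w i j • (x j - x i) := by
    simp only [laplacian, Matrix.sub_apply, Matrix.diagonal_apply, sub_smul, ite_smul, zero_smul,
      Finset.sum_sub_distrib, Finset.sum_ite_eq, Finset.mem_univ, if_true, smul_sub,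
      ← Finset.sum_smul]
    abel
  simp only [closedLoop, h]

/-- All (maximal) Filippov solutions of `ẋ = g(x)` converge to static consensus in finite time: each of them is
defined for all `t ≥ 0`, and there are a time `t* > 0` and a vector `x̄ ∈ ℝ^k` with `x(t) = 𝟙 ⊗ x̄`,
that is, `x_i(t) = x̄` for every agent `i`, for all `t ≥ t*`. -/
def FiniteTimeStaticConsensus {n k : ℕ} (g : State n k → State n k) : Prop :=
  ∀ (J : Set ℝ) (x : ℝ → State n k), IsMaximalFilippovSolution g J x →
    J = Ici 0 ∧ ∃ tstar : ℝ, 0 < tstar ∧ ∃ xbar : EuclideanSpace ℝ (Fin k),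
      ∀ t, tstar ≤ t → ∀ i, x t i = xbar

end FiniteTimeConsensus

/-! The energy V(x) = ⟨x, Lx⟩ vanishes exactly at consensus. For a Filippov velocity v, half its
rate of change is ⟨Lx, v⟩. Wherever `f i` is continuous at its input, v i is forced to be the
feedback value. Continuous agents therefore contribute at most 0 to ⟨Lx, v⟩, and each signum agent
at most -c‖(Lx) i‖ (`IsAdmissible.exists_inner_lap_le`). Hence V is nonincreasing and Lx stays
bounded. Since the feedbacks see only Lx, velocities are bounded too, and local existence (a limit
of Euler polygons) makes maximal solutions global.

With at most one continuous agent, the blocks of Lx sum to zero, so the signum agents control all of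
Lx. Together with V ≤ C‖Lx‖² this makes √V decrease at a fixed rate until it vanishes. The limit is
static if some linear functional that identifies the consensus value has zero velocity on consensus
states: the position of the only continuous agent, or x 0 + x 1 when n = 2 and both agents use the
signum.

With no continuous agent and n > 2, some velocities at consensus send one agent along -s and all
others along s. Averaging over the exceptional agent gives a common velocity ((n - 2)/n)s, so
consensus can drift forever (`IsAdmissible.consensus_mem_filippovMap`).

With two or more continuous agents, there are non-consensus states at which every signum agent sees
zero disagreement. There the signum agents may take any velocity of ℓ_p norm at most 1, in
particular the one that preserves this constraint. The resulting sliding motion follows a continuous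
field of linear growth around each consensus state, so it never reaches consensus in finite time
(`IsFilippovSolution.ne_of_norm_le`). -/

open Filter Topology
open scoped NNReal

namespace FiniteTimeConsensus

/-! ### Absolutely continuous curves -/

section AbsolutelyContinuous

theorem absolutelyContinuous_lipschitz_comp {X Y : Type*} [PseudoMetricSpace X]
    [PseudoMetricSpace Y] {f : ℝ → X} {φ : X → Y} {K : ℝ≥0} {a b : ℝ}
    (hφ : LipschitzOnWith K φ (f '' uIcc a b)) (hf : AbsolutelyContinuousOnInterval f a b) :
    AbsolutelyContinuousOnInterval (fun t => φ (f t)) a b := by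
  rw [absolutelyContinuousOnInterval_iff] at hf ⊢
  intro ε hε
  obtain ⟨δ, hδ, h⟩ := hf (ε / (K + 1)) (by positivity)
  refine ⟨δ, hδ, fun E hE hl => ?_⟩
  have h1 := h E hE hl
  calc _ ≤ ∑ i ∈ Finset.range E.1, K * dist (f (E.2 i).1) (f (E.2 i).2) :=
        Finset.sum_le_sum fun i hi => hφ.dist_le_mul _ (mem_image_of_mem _ (hE.1 i hi).1) _
          (mem_image_of_mem _ (hE.1 i hi).2)
    _ = K * ∑ i ∈ Finset.range E.1, dist (f (E.2 i).1) (f (E.2 i).2) := by rw [Finset.mul_sum]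
    _ ≤ K * (ε / (K + 1)) := by gcongr
    _ < (K + 1) * (ε / (K + 1)) := by gcongr; linarith
    _ = ε := by field

theorem absolutelyContinuous_clm_comp {E F : Type*} [NormedAddCommGroup E] [NormedSpace ℝ E]
    [NormedAddCommGroup F] [NormedSpace ℝ F] (P : E →L[ℝ] F) {f : ℝ → E} {a b : ℝ}
    (hf : AbsolutelyContinuousOnInterval f a b) :
    AbsolutelyContinuousOnInterval (fun t => P (f t)) a b :=
  absolutelyContinuous_lipschitz_comp P.lipschitz.lipschitzOnWith hf

theorem sub_le_mul_of_ae_deriv_le {f : ℝ → ℝ} {a b c : ℝ} (hab : a ≤ b)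
    (hf : AbsolutelyContinuousOnInterval f a b)
    (h : ∀ᵐ t : ℝ, t ∈ Ioo a b → ∃ d ≤ c, HasDerivAt f d t) : f b - f a ≤ c * (b - a) := by
  rw [← hf.integral_deriv_eq_sub]
  calc ∫ t in a..b, deriv f t ≤ ∫ _ in a..b, c := by
        refine intervalIntegral.integral_mono_ae_restrict hab hf.intervalIntegrable_deriv
          intervalIntegrable_const ?_
        rw [← Measure.restrict_congr_set Ioo_ae_eq_Icc]
        refine (ae_restrict_iff' measurableSet_Ioo).2 ?_
        filter_upwards [h] with t ht htab
        obtain ⟨d, hd, hd'⟩ := ht htab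
        rw [hd'.deriv]
        exact hd
    _ = c * (b - a) := by simp [mul_comm]

/-- Pairing the curve with its own increment u = f b - f a reduces the claim to the scalar estimate,
which gives ‖u‖² ≤ ‖u‖ M (b - a). -/
theorem norm_sub_le_mul_of_ae_deriv_le {E : Type*} [NormedAddCommGroup E] [InnerProductSpace ℝ E]
    {f : ℝ → E} {a b M : ℝ} (hab : a ≤ b) (hf : AbsolutelyContinuousOnInterval f a b)
    (h : ∀ᵐ t : ℝ, t ∈ Ioo a b → ∃ v, ‖v‖ ≤ M ∧ HasDerivAt f v t) :
    ‖f b - f a‖ ≤ M * (b - a) := by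
  set u := f b - f a with hu
  have h1 := sub_le_mul_of_ae_deriv_le (f := fun t => innerSL ℝ u (f t)) (c := ‖u‖ * M) hab
    (absolutelyContinuous_clm_comp _ hf) (by
      filter_upwards [h] with t ht htab
      obtain ⟨v, hv, hd⟩ := ht htab
      refine ⟨innerSL ℝ u v, ?_, (innerSL ℝ u).hasFDerivAt.comp_hasDerivAt t hd⟩
      calc _ ≤ ‖u‖ * ‖v‖ := real_inner_le_norm _ _
        _ ≤ _ := by gcongr)
  rw [← map_sub, ← hu, innerSL_apply_apply, real_inner_self_eq_norm_sq] at h1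
  rcases (norm_nonneg u).eq_or_lt with h0 | h0
  -- If u = 0, what remains is 0 ≤ M (b - a). When a < b, the sign of M comes from a time at which
  -- the derivative bound holds.
  · rw [← h0]
    rcases hab.eq_or_lt with rfl | hlt
    · simp
    · have hne : ∃ t, t ∈ Ioo a b ∧ ∃ v, ‖v‖ ≤ M ∧ HasDerivAt f v t := by
        by_contra hcon
        push Not at hcon
        have : volume (Ioo a b) = 0 := by
          refine measure_mono_null ?_ h
          intro t ht
          simp only [mem_compl_iff, mem_ofPred_eq]
          intro h'
          obtain ⟨v, hv, hd⟩ := h' ht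
          exact hcon t ht v hv hd
        simp at this
        linarith
      obtain ⟨t, -, v, hv, -⟩ := hne
      exact mul_nonneg ((norm_nonneg v).trans hv) (by linarith)
  · nlinarith

end AbsolutelyContinuous

/-! ### Filippov maps -/

section Filippov

variable {E F : Type*} [NormedAddCommGroup E] [NormedSpace ℝ E] [MeasureSpace E]
  [NormedAddCommGroup F] [NormedSpace ℝ F] {g g' : E → E} {x v : E}

theorem mem_filippovMap : v ∈ filippovMap g x ↔ ∀ δ : ℝ, 0 < δ → ∀ S : Set E, volume S = 0 →
    v ∈ closure (convexHull ℝ (g '' (Metric.ball x δ \ S))) := by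
  simp [filippovMap]

theorem convex_filippovMap (g : E → E) (x : E) : Convex ℝ (filippovMap g x) :=
  convex_iInter fun _ => convex_iInter fun _ => convex_iInter fun _ => convex_iInter fun _ =>
    (convex_convexHull ℝ _).closure

/-- The empty null set and one small ball already suffice: upper bounds on Filippov velocities need
no exceptional set. -/
theorem clm_mem_of_mem_filippovMap (P : E →L[ℝ] F) {K : Set F} (hK : IsClosed K)
    (hK' : Convex ℝ K) (h : ∀ᶠ z in 𝓝 x, P (g z) ∈ K) (hv : v ∈ filippovMap g x) : P v ∈ K := by
  obtain ⟨δ, hδ, hb⟩ := Metric.eventually_nhds_iff_ball.1 h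
  have h1 := mem_filippovMap.1 hv δ hδ ∅ measure_empty
  refine closure_minimal (convexHull_min ?_ (hK'.linear_preimage P.toLinearMap))
    (hK.preimage P.continuous) h1
  rintro _ ⟨z, hz, rfl⟩
  exact hb z hz.1

theorem clm_eq_of_mem_filippovMap (P : E →L[ℝ] F) (h : ContinuousAt (fun z => P (g z)) x)
    (hv : v ∈ filippovMap g x) : P v = P (g x) := by
  refine eq_of_forall_dist_le fun ε hε => ?_
  exact clm_mem_of_mem_filippovMap P Metric.isClosed_closedBall (convex_closedBall (P (g x)) ε)
    (h.eventually (Metric.closedBall_mem_nhds _ hε)) hv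

theorem filippovMap_subset_of_eventuallyEq (h : g =ᶠ[𝓝 x] g') :
    filippovMap g x ⊆ filippovMap g' x := by
  intro v hv
  obtain ⟨ε, hε, hb⟩ := Metric.eventually_nhds_iff_ball.1 h
  refine mem_filippovMap.2 fun δ hδ S hS => ?_
  refine closure_mono (convexHull_mono ?_) (mem_filippovMap.1 hv (min δ ε) (lt_min hδ hε) S hS)
  rintro _ ⟨z, hz, rfl⟩
  exact ⟨z, ⟨Metric.ball_subset_ball (min_le_left _ _) hz.1, hz.2⟩,
    (hb z (Metric.ball_subset_ball (min_le_right _ _) hz.1)).symm⟩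

/-- Null sets have dense complement, so a value of `g` at a point of continuity survives, up to
closure, the removal of any null set. -/
theorem mem_filippovMap_of_tendsto [(volume : Measure E).IsOpenPosMeasure] {α : Type*}
    {l : Filter α} [l.NeBot] {u : α → E} (hu : Tendsto u l (𝓝 x))
    (hc : ∀ᶠ a in l, ContinuousAt g (u a)) (hv : Tendsto (fun a => g (u a)) l (𝓝 v)) :
    v ∈ filippovMap g x := by
  refine mem_filippovMap.2 fun δ hδ S hS => ?_
  refine isClosed_closure.mem_of_tendsto hv ?_
  filter_upwards [hc, hu.eventually (Metric.ball_mem_nhds x hδ)] with a ha hb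
  refine closure_mono (subset_convexHull ℝ _) ?_
  have hd : Dense Sᶜ := Measure.dense_of_ae (μ := volume) (p := fun z => z ∉ S)
    (measure_eq_zero_iff_ae_notMem.1 hS)
  exact ha.continuousWithinAt.mem_closure_image
    (hd.open_subset_closure_inter Metric.isOpen_ball hb)

/-- The sets being intersected are nonempty and compact, and they form a directed family: shrink the
ball and unite the null sets. -/
theorem filippovMap_nonempty [FiniteDimensional ℝ E] [(volume : Measure E).IsOpenPosMeasure]
    {M : ℝ} (hg : ∀ z, ‖g z‖ ≤ M) (x : E) : (filippovMap g x).Nonempty := by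
  have : ProperSpace E := FiniteDimensional.proper ℝ E
  let t : {δ : ℝ // 0 < δ} × {S : Set E // volume S = 0} → Set E := fun i =>
    closure (convexHull ℝ (g '' (Metric.ball x i.1.1 \ i.2.1)))
  have : Nonempty ({δ : ℝ // 0 < δ} × {S : Set E // volume S = 0}) :=
    ⟨⟨1, one_pos⟩, ⟨∅, measure_empty⟩⟩
  have ht : (⋂ i, t i).Nonempty := by
    refine IsCompact.nonempty_iInter_of_directed_nonempty_isCompact_isClosed t ?_ ?_ ?_ ?_
    · rintro ⟨⟨δ, hδ⟩, S, hS⟩ ⟨⟨δ', hδ'⟩, S', hS'⟩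
      refine ⟨⟨⟨min δ δ', lt_min hδ hδ'⟩, S ∪ S', measure_union_null hS hS'⟩, ?_, ?_⟩
      · refine closure_mono (convexHull_mono (image_mono ?_))
        exact sdiff_subset_sdiff (Metric.ball_subset_ball (min_le_left _ _)) subset_union_left
      · refine closure_mono (convexHull_mono (image_mono ?_))
        exact sdiff_subset_sdiff (Metric.ball_subset_ball (min_le_right _ _)) subset_union_right
    · rintro ⟨⟨δ, hδ⟩, S, hS⟩
      refine Nonempty.closure (Nonempty.convexHull (Nonempty.image _ ?_))
      by_contra hcon
      rw [not_nonempty_iff_eq_empty, sdiff_eq_empty] at hcon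
      exact (Metric.measure_ball_pos volume x hδ).ne' (measure_mono_null hcon hS)
    · rintro i
      refine (isCompact_closedBall (0 : E) M).of_isClosed_subset isClosed_closure ?_
      refine closure_minimal (convexHull_min ?_ (convex_closedBall _ _)) Metric.isClosed_closedBall
      rintro _ ⟨z, -, rfl⟩
      simpa using hg z
    · exact fun i => isClosed_closure
  obtain ⟨v, hv⟩ := ht
  exact ⟨v, mem_filippovMap.2 fun δ hδ S hS => mem_iInter.1 hv (⟨δ, hδ⟩, ⟨S, hS⟩)⟩

theorem norm_le_of_mem_filippovMap {M : ℝ} (hg : ∀ z, ‖g z‖ ≤ M) (hv : v ∈ filippovMap g x) :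
    ‖v‖ ≤ M := by
  have := clm_mem_of_mem_filippovMap (ContinuousLinearMap.id ℝ E)
    (Metric.isClosed_closedBall (x := (0 : E)) (ε := M)) (convex_closedBall _ _)
    (Eventually.of_forall fun z => by simpa using hg z) hv
  simpa using this

end Filippov

/-! ### Existence of solutions -/

section Existence

variable {E : Type*} [NormedAddCommGroup E] [NormedSpace ℝ E]

/-- The Euler polygon of the vector field `s` with step `h`. -/
noncomputable def eulerPoint (s : E → E) (x₀ : E) (h : ℝ) : ℕ → E
  | 0 => x₀
  | j + 1 => eulerPoint s x₀ h j + h • s (eulerPoint s x₀ h j)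

theorem eulerPoint_sub (s : E → E) (x₀ : E) (h : ℝ) {i j : ℕ} (hij : i ≤ j) :
    eulerPoint s x₀ h j - eulerPoint s x₀ h i =
      h • ∑ l ∈ Finset.Ico i j, s (eulerPoint s x₀ h l) := by
  induction j, hij using Nat.le_induction with
  | base => simp
  | succ j hij ih =>
    rw [Finset.sum_Ico_succ_top hij, smul_add, ← ih, eulerPoint]
    abel

theorem norm_eulerPoint_sub_le {s : E → E} {M : ℝ} (hs : ∀ z, ‖s z‖ ≤ M) (x₀ : E) {h : ℝ}
    (hh : 0 ≤ h) {i j : ℕ} (hij : i ≤ j) :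
    ‖eulerPoint s x₀ h j - eulerPoint s x₀ h i‖ ≤ M * (h * ((j : ℝ) - i)) := by
  rw [eulerPoint_sub s x₀ h hij, norm_smul, Real.norm_of_nonneg hh]
  have : ‖∑ l ∈ Finset.Ico i j, s (eulerPoint s x₀ h l)‖ ≤ ((j : ℝ) - i) * M := by
    refine (norm_sum_le_of_le _ fun l _ => hs _).trans_eq ?_
    simp [Nat.cast_sub hij]
  calc _ ≤ h * (((j : ℝ) - i) * M) := by gcongr
    _ = _ := by ring

/-- The Euler step function with step `1 / (m + 1)`. -/
noncomputable def eulerCurve (s : E → E) (x₀ : E) (m : ℕ) (t : ℝ) : E :=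
  eulerPoint s x₀ (1 / (m + 1)) ⌊t * (m + 1)⌋₊

theorem natFloor_sub_le {a b : ℝ} (hab : a ≤ b) : (⌊b⌋₊ : ℝ) - ⌊a⌋₊ ≤ b - a + 1 := by
  rcases le_total b 0 with hb | hb
  · rw [Nat.floor_of_nonpos hb, Nat.floor_of_nonpos (hab.trans hb)]
    simp
    linarith
  · have := Nat.floor_le hb
    have := Nat.lt_floor_add_one a
    linarith

theorem norm_eulerCurve_sub_le {s : E → E} {M : ℝ} (hs : ∀ z, ‖s z‖ ≤ M) (x₀ : E) (m : ℕ)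
    {a b : ℝ} (hab : a ≤ b) :
    ‖eulerCurve s x₀ m b - eulerCurve s x₀ m a‖ ≤ M * (b - a + 1 / (m + 1)) := by
  have hM : 0 ≤ M := (norm_nonneg _).trans (hs 0)
  have hm : (0 : ℝ) < m + 1 := by positivity
  have h1 : a * (m + 1 : ℝ) ≤ b * (m + 1) := by gcongr
  refine (norm_eulerPoint_sub_le hs x₀ (by positivity) (Nat.floor_mono h1)).trans ?_
  gcongr
  calc _ ≤ 1 / (m + 1 : ℝ) * (b * (m + 1) - a * (m + 1) + 1) := by
        gcongr
        exact natFloor_sub_le h1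
    _ = _ := by field

theorem tendsto_one_div_hyperfilter :
    Tendsto (fun m : ℕ => 1 / ((m : ℝ) + 1)) (hyperfilter ℕ : Filter ℕ) (𝓝 0) :=
  tendsto_one_div_add_atTop_nhds_zero_nat.mono_left Nat.hyperfilter_le_atTop

/-- At each time the curves remain in a fixed ball. An ultrafilter limit handles all times at once,
without extracting a subsequence. -/
theorem exists_tendsto_eulerCurve [FiniteDimensional ℝ E] {s : E → E} {M : ℝ}
    (hs : ∀ z, ‖s z‖ ≤ M) (x₀ : E) :
    ∃ X : ℝ → E, ∀ t, Tendsto (fun m => eulerCurve s x₀ m t) (hyperfilter ℕ) (𝓝 (X t)) := by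
  have : ProperSpace E := FiniteDimensional.proper ℝ E
  have hM : 0 ≤ M := (norm_nonneg _).trans (hs 0)
  refine Classical.axiomOfChoice (r := fun t z =>
    Tendsto (fun m => eulerCurve s x₀ m t) (hyperfilter ℕ) (𝓝 z)) fun t => ?_
  obtain ⟨z, -, hz⟩ := (isCompact_closedBall x₀ (M * (|t| + 1))).ultrafilter_le_nhds
    ((hyperfilter ℕ).map fun m => eulerCurve s x₀ m t) (by
      refine tendsto_principal.2 (Eventually.of_forall fun m => ?_)
      have hm : 1 / ((m : ℝ) + 1) ≤ 1 := by
        rw [div_le_one (by positivity)]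
        linarith [(Nat.cast_nonneg m : (0 : ℝ) ≤ m)]
      have h0 : eulerCurve s x₀ m 0 = x₀ := by simp [eulerCurve, eulerPoint]
      rw [Metric.mem_closedBall, dist_eq_norm]
      rcases le_total 0 t with ht | ht
      · have := norm_eulerCurve_sub_le hs x₀ m ht
        rw [h0] at this
        refine this.trans ?_
        rw [abs_of_nonneg ht]
        gcongr
        linarith
      · have := norm_eulerCurve_sub_le hs x₀ m ht
        rw [h0, norm_sub_rev] at this
        refine this.trans ?_
        rw [abs_of_nonpos ht]
        gcongr
        linarith)
  exact ⟨z, hz⟩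

theorem norm_sub_le_of_tendsto_eulerCurve {s : E → E} {M : ℝ} (hs : ∀ z, ‖s z‖ ≤ M) {x₀ : E}
    {X : ℝ → E} (hX : ∀ t, Tendsto (fun m => eulerCurve s x₀ m t) (hyperfilter ℕ) (𝓝 (X t)))
    {a b : ℝ} (hab : a ≤ b) : ‖X b - X a‖ ≤ M * (b - a) := by
  have h1 := ((hX b).sub (hX a)).norm
  have h2 : Tendsto (fun m : ℕ => M * (b - a + 1 / ((m : ℝ) + 1))) (hyperfilter ℕ : Filter ℕ)
      (𝓝 (M * (b - a + 0))) := (tendsto_const_nhds.add tendsto_one_div_hyperfilter).const_mul M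
  rw [add_zero] at h2
  exact le_of_tendsto_of_tendsto' h1 h2 fun m => norm_eulerCurve_sub_le hs x₀ m hab

/-- A difference quotient of the Euler curve is an average of selected velocities at nearby points,
hence lies in `K`; closedness carries this to the limit. -/
theorem slope_mem_of_tendsto_eulerCurve {s : E → E} {M : ℝ} (hs : ∀ z, ‖s z‖ ≤ M) {x₀ : E}
    {X : ℝ → E} (hX : ∀ t, Tendsto (fun m => eulerCurve s x₀ m t) (hyperfilter ℕ) (𝓝 (X t)))
    {K : Set E} (hK : IsClosed K) (hK' : Convex ℝ K) {t δ τ : ℝ} (ht : 0 ≤ t) (hτ : 0 < τ)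
    (hδ : ∀ z, dist z (X t) < δ → s z ∈ K) (hτδ : M * τ < δ) :
    τ⁻¹ • (X (t + τ) - X t) ∈ K := by
  have hM : 0 ≤ M := (norm_nonneg _).trans (hs 0)
  set i : ℕ → ℕ := fun m => ⌊t * (m + 1)⌋₊ with hi
  set j : ℕ → ℕ := fun m => ⌊(t + τ) * (m + 1)⌋₊ with hj
  have hfl : ∀ a : ℝ, 0 ≤ a → Tendsto (fun m : ℕ => (⌊a * (m + 1)⌋₊ : ℝ) / ((m : ℝ) + 1))
      (hyperfilter ℕ : Filter ℕ) (𝓝 a) := fun a ha =>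
    ((tendsto_nat_floor_mul_div_atTop ha).comp
      (tendsto_atTop_add_const_right _ 1 tendsto_natCast_atTop_atTop)).mono_left
      Nat.hyperfilter_le_atTop
  have hρ : Tendsto (fun m : ℕ => (j m : ℝ) / ((m : ℝ) + 1) - (i m : ℝ) / ((m : ℝ) + 1))
      (hyperfilter ℕ : Filter ℕ) (𝓝 τ) := by
    simpa using (hfl (t + τ) (by linarith)).sub (hfl t ht)
  have hlim := (hρ.inv₀ hτ.ne').smul ((hX (t + τ)).sub (hX t))
  refine hK.mem_of_tendsto hlim ?_
  have hsmall : Tendsto (fun m : ℕ => M * (τ + 1 / ((m : ℝ) + 1)) + dist (eulerCurve s x₀ m t) (X t))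
      (hyperfilter ℕ : Filter ℕ) (𝓝 (M * (τ + 0) + 0)) :=
    ((tendsto_const_nhds.add tendsto_one_div_hyperfilter).const_mul M).add
      (tendsto_iff_dist_tendsto_zero.1 (hX t))
  filter_upwards [hρ.eventually (lt_mem_nhds hτ), hsmall.eventually (gt_mem_nhds
    (by simpa using hτδ : M * (τ + 0) + 0 < δ))] with m hm hm2
  have hm1 : (0 : ℝ) < m + 1 := by positivity
  have hij : i m < j m := by
    rw [← sub_div] at hm
    have := (div_pos_iff_of_pos_right hm1).1 hm
    exact_mod_cast sub_pos.1 this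
  have hji : (0 : ℝ) < (j m : ℝ) - i m := sub_pos.2 (by exact_mod_cast hij)
  have heq : ((j m : ℝ) / ((m : ℝ) + 1) - (i m : ℝ) / ((m : ℝ) + 1))⁻¹ •
      (eulerCurve s x₀ m (t + τ) - eulerCurve s x₀ m t) = ∑ l ∈ Finset.Ico (i m) (j m),
        ((j m : ℝ) - i m)⁻¹ • s (eulerPoint s x₀ (1 / (m + 1)) l) := by
    rw [eulerCurve, eulerCurve, eulerPoint_sub s x₀ _ hij.le, smul_smul, Finset.smul_sum]
    refine Finset.sum_congr rfl fun l _ => ?_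
    congr 1
    rw [← sub_div]
    field_simp
  rw [heq]
  refine hK'.sum_mem (fun l _ => (inv_pos.2 hji).le) ?_ fun l hl => hδ _ ?_
  · rw [Finset.sum_const, Nat.card_Ico, nsmul_eq_mul, Nat.cast_sub hij.le]
    exact mul_inv_cancel₀ hji.ne'
  · rw [Finset.mem_Ico] at hl
    refine lt_of_le_of_lt (dist_triangle _ (eulerCurve s x₀ m t) _) (lt_of_le_of_lt ?_ hm2)
    gcongr
    rw [dist_eq_norm, eulerCurve]
    refine (norm_eulerPoint_sub_le hs x₀ (by positivity) hl.1).trans ?_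
    gcongr
    have h3 : (l : ℝ) ≤ j m := by exact_mod_cast hl.2.le
    have h4 : (j m : ℝ) - i m ≤ (t + τ) * (m + 1) - t * (m + 1) + 1 :=
      natFloor_sub_le (by gcongr; linarith)
    calc _ ≤ 1 / (m + 1 : ℝ) * ((t + τ) * (m + 1) - t * (m + 1) + 1) := by
          refine mul_le_mul_of_nonneg_left ?_ (by positivity)
          linarith
      _ = _ := by field

/-- A bounded vector field has a global Filippov solution from every initial state. -/
theorem exists_lipschitz_filippov_solution [FiniteDimensional ℝ E] [MeasureSpace E]
    [(volume : Measure E).IsOpenPosMeasure] {g : E → E} {M : ℝ} (hg : ∀ z, ‖g z‖ ≤ M) (x₀ : E) :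
    ∃ X : ℝ → E, LipschitzWith M.toNNReal X ∧ X 0 = x₀ ∧
      ∀ᵐ t : ℝ, 0 ≤ t → ∃ v ∈ filippovMap g (X t), HasDerivAt X v t := by
  have hM : 0 ≤ M := (norm_nonneg _).trans (hg 0)
  choose s hs using filippovMap_nonempty (g := g) hg
  have hsM : ∀ z, ‖s z‖ ≤ M := fun z => norm_le_of_mem_filippovMap hg (hs z)
  obtain ⟨X, hX⟩ := exists_tendsto_eulerCurve hsM x₀
  have hlip : LipschitzWith M.toNNReal X := by
    refine LipschitzWith.of_dist_le_mul fun a b => ?_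
    rw [Real.coe_toNNReal _ hM]
    rcases le_total a b with hab | hab
    · rw [dist_comm, dist_eq_norm, Real.dist_eq, abs_sub_comm, abs_of_nonneg (sub_nonneg.2 hab)]
      exact norm_sub_le_of_tendsto_eulerCurve hsM hX hab
    · rw [dist_eq_norm, Real.dist_eq, abs_of_nonneg (sub_nonneg.2 hab)]
      exact norm_sub_le_of_tendsto_eulerCurve hsM hX hab
  refine ⟨X, hlip, ?_, ?_⟩
  · refine tendsto_nhds_unique (hX 0) ?_
    simp [eulerCurve, eulerPoint]
  · filter_upwards [hlip.ae_differentiableAt_real] with t hd ht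
    refine ⟨deriv X t, mem_filippovMap.2 fun δ hδ S hS => ?_, hd.hasDerivAt⟩
    refine isClosed_closure.mem_of_tendsto hd.hasDerivAt.tendsto_slope_zero_right ?_
    have hτ : ∀ᶠ τ : ℝ in 𝓝[>] 0, M * τ < δ := by
      refine nhdsWithin_le_nhds ?_
      have : Tendsto (fun τ : ℝ => M * τ) (𝓝 0) (𝓝 (M * 0)) := tendsto_id.const_mul M
      exact this.eventually (gt_mem_nhds (by simpa using hδ))
    filter_upwards [hτ, self_mem_nhdsWithin] with τ hτ1 hτ2
    refine slope_mem_of_tendsto_eulerCurve hsM hX isClosed_closure (convex_convexHull ℝ _).closure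
      ht hτ2 (fun z hz => ?_) hτ1
    refine closure_mono (convexHull_mono (image_mono ?_))
      (mem_filippovMap.1 (hs z) (δ - dist z (X t)) (sub_pos.2 hz) S hS)
    refine sdiff_subset_sdiff_left (Metric.ball_subset_ball' ?_)
    linarith

end Existence

/-! ### The direction-preserving signum -/

section DirSign

variable {k : ℕ} (p : ℝ≥0∞) [Fact (1 ≤ p)]

/-- The identity of `ℝ^k`, from the Euclidean norm to the `ℓ_p` norm. -/
noncomputable def toLpEquiv (k : ℕ) : EuclideanSpace ℝ (Fin k) ≃L[ℝ] PiLp p (fun _ : Fin k => ℝ) :=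
  (PiLp.continuousLinearEquiv 2 ℝ _).trans (PiLp.continuousLinearEquiv p ℝ _).symm

theorem dirSign_eq (y : EuclideanSpace ℝ (Fin k)) : dirSign p y = ‖toLpEquiv p k y‖⁻¹ • y := by
  unfold dirSign
  split_ifs with h
  · simp [h]
  · rfl

theorem dirSign_neg (y : EuclideanSpace ℝ (Fin k)) : dirSign p (-y) = -dirSign p y := by
  simp [dirSign_eq]

theorem dirSign_smul {r : ℝ} (hr : 0 < r) (y : EuclideanSpace ℝ (Fin k)) :
    dirSign p (r • y) = dirSign p y := by
  rw [dirSign_eq, dirSign_eq, map_smul, norm_smul, Real.norm_of_nonneg hr.le, smul_smul]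
  congr 1
  field_simp

theorem norm_toLpEquiv_pos {y : EuclideanSpace ℝ (Fin k)} (hy : y ≠ 0) :
    0 < ‖toLpEquiv p k y‖ := by simpa using hy

theorem dirSign_ne_zero {y : EuclideanSpace ℝ (Fin k)} (hy : y ≠ 0) : dirSign p y ≠ 0 := by
  rw [dirSign_eq]
  exact smul_ne_zero (inv_pos.2 (norm_toLpEquiv_pos p hy)).ne' hy

theorem continuousAt_dirSign {y : EuclideanSpace ℝ (Fin k)} (hy : y ≠ 0) :
    ContinuousAt (dirSign p) y := by
  have h : (dirSign p : EuclideanSpace ℝ (Fin k) → _) = fun y => ‖toLpEquiv p k y‖⁻¹ • y :=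
    funext (dirSign_eq p)
  rw [h]
  exact ((toLpEquiv p k).continuous.norm.continuousAt.inv₀ (norm_toLpEquiv_pos p hy).ne').smul
    continuousAt_id

theorem exists_norm_dirSign_le (k : ℕ) :
    ∃ c : ℝ, 0 < c ∧ ∀ y : EuclideanSpace ℝ (Fin k), ‖dirSign p y‖ ≤ c := by
  refine ⟨‖(toLpEquiv p k).symm.toContinuousLinearMap‖ + 1, by positivity,
    fun y => ?_⟩
  rcases eq_or_ne y 0 with rfl | hy
  · simp only [dirSign_eq, smul_zero, norm_zero]
    positivity
  · have h := norm_toLpEquiv_pos p hy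
    rw [dirSign_eq, norm_smul, norm_inv, norm_norm, inv_mul_le_iff₀ h]
    have := (toLpEquiv p k).symm.toContinuousLinearMap.le_opNorm
      (toLpEquiv p k y)
    simp only [ContinuousLinearEquiv.coe_coe, ContinuousLinearEquiv.symm_apply_apply] at this
    nlinarith

theorem exists_le_inner_dirSign (k : ℕ) :
    ∃ c : ℝ, 0 < c ∧ ∀ y : EuclideanSpace ℝ (Fin k), c * ‖y‖ ≤ inner ℝ y (dirSign p y) := by
  refine ⟨(‖(toLpEquiv p k).toContinuousLinearMap‖ + 1)⁻¹, by positivity, fun y => ?_⟩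
  rcases eq_or_ne y 0 with rfl | hy
  · simp
  · have h := norm_toLpEquiv_pos p hy
    have hy' := norm_pos_iff.2 hy
    rw [dirSign_eq, inner_smul_right, real_inner_self_eq_norm_sq, inv_mul_eq_div, inv_mul_eq_div,
      div_le_div_iff₀ (by positivity) h]
    have := (toLpEquiv p k).toContinuousLinearMap.le_opNorm y
    simp only [ContinuousLinearEquiv.coe_coe] at this
    nlinarith

end DirSign

/-! ### The Laplacian of a connected network -/

section Network

variable {n k : ℕ}

/-- The properties of the weighted adjacency matrix of a connected graph. -/
structure IsNetwork (A : Matrix (Fin n) (Fin n) ℝ) : Prop where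
  symm : ∀ i j, A i j = A j i
  nonneg : ∀ i j, 0 ≤ A i j
  connected : ∀ i j, Relation.ReflTransGen (fun i j => 0 < A i j) i j

theorem isNetwork_adjacency {G : SimpleGraph (Fin n)} (hG : G.Connected)
    {w : Fin n → Fin n → ℝ} (hw_symm : ∀ i j, w i j = w j i)
    (hw_pos : ∀ i j, G.Adj i j → 0 < w i j) : IsNetwork (adjacency G w) where
  symm i j := by
    simp only [adjacency, Matrix.of_apply]
    split_ifs with h h' h'
    exacts [hw_symm i j, absurd h.symm h', absurd h'.symm h, rfl]
  nonneg i j := by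
    simp only [adjacency, Matrix.of_apply]
    split_ifs with h
    exacts [(hw_pos i j h).le, le_rfl]
  connected i j := by
    refine Relation.ReflTransGen.mono (fun a b hab => ?_) i j
      ((SimpleGraph.reachable_iff_reflTransGen i j).1 (hG.preconnected i j))
    simpa [adjacency, hab] using hw_pos a b hab

/-- The position of agent `i`. -/
noncomputable def agent (i : Fin n) : State n k →L[ℝ] EuclideanSpace ℝ (Fin k) :=
  PiLp.proj 2 (fun _ : Fin n => EuclideanSpace ℝ (Fin k)) i

@[simp]
theorem agent_apply (i : Fin n) (x : State n k) : agent i x = x i := rfl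

/-- The linear map on states with given components. -/
noncomputable def ofAgents (P : Fin n → State n k →L[ℝ] EuclideanSpace ℝ (Fin k)) :
    State n k →L[ℝ] State n k :=
  (PiLp.continuousLinearEquiv 2 ℝ (fun _ : Fin n => EuclideanSpace ℝ (Fin k))).symm.toContinuousLinearMap.comp
    (ContinuousLinearMap.pi P)

theorem ofAgents_apply (P : Fin n → State n k →L[ℝ] EuclideanSpace ℝ (Fin k)) (x : State n k)
    (i : Fin n) : ofAgents P x i = P i x := rfl

/-- The action of the Laplacian on states, `x ↦ (L ⊗ I_k) x`. -/
noncomputable def lap (A : Matrix (Fin n) (Fin n) ℝ) : State n k →L[ℝ] State n k :=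
  ofAgents fun i => ∑ j, A i j • (agent i - agent j)

theorem lap_apply (A : Matrix (Fin n) (Fin n) ℝ) (x : State n k) (i : Fin n) :
    lap A x i = ∑ j, A i j • (x i - x j) := by
  simp [lap, ofAgents_apply]

theorem closedLoop_eq (G : SimpleGraph (Fin n)) (w : Fin n → Fin n → ℝ)
    (f : Fin n → EuclideanSpace ℝ (Fin k) → EuclideanSpace ℝ (Fin k)) (x : State n k) (i : Fin n) :
    closedLoop G w f x i = f i (-lap (adjacency G w) x i) := by
  rw [closedLoop_apply, lap_apply, ← Finset.sum_neg_distrib]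
  congr 1
  refine Finset.sum_congr rfl fun j _ => ?_
  rw [← smul_neg, neg_sub]

variable {A : Matrix (Fin n) (Fin n) ℝ}

/-- Symmetrising the double sum writes the form over edges; self-adjointness, nonnegativity and the
kernel of L are all read off from it. -/
theorem IsNetwork.two_mul_inner_lap (hA : IsNetwork A) (x z : State n k) :
    2 * inner ℝ x (lap A z) = ∑ i, ∑ j, A i j * inner ℝ (x i - x j) (z i - z j) := by
  have h1 : inner ℝ x (lap A z) = ∑ i, ∑ j, A i j * inner ℝ (x i) (z i - z j) := by
    simp only [PiLp.inner_apply, lap_apply, inner_sum, inner_smul_right]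
  have h2 : inner ℝ x (lap A z) = ∑ i, ∑ j, A i j * inner ℝ (x j) (z j - z i) := by
    rw [h1, Finset.sum_comm]
    simp only [hA.symm]
  rw [two_mul]
  nth_rewrite 1 [h1]
  rw [h2, ← Finset.sum_add_distrib]
  refine Finset.sum_congr rfl fun i _ => ?_
  rw [← Finset.sum_add_distrib]
  refine Finset.sum_congr rfl fun j _ => ?_
  rw [← mul_add, inner_sub_left, ← neg_sub (z i) (z j), inner_neg_right, ← sub_eq_add_neg]

theorem IsNetwork.inner_lap_comm (hA : IsNetwork A) (x z : State n k) :
    inner ℝ x (lap A z) = inner ℝ (lap A x) z := by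
  have h1 := hA.two_mul_inner_lap x z
  have h2 := hA.two_mul_inner_lap z x
  simp only [real_inner_comm (z _ - z _) (x _ - x _)] at h1
  rw [real_inner_comm z (lap A x)] at *
  linarith

theorem IsNetwork.inner_lap_nonneg (hA : IsNetwork A) (x : State n k) :
    0 ≤ inner ℝ x (lap A x) := by
  have h := hA.two_mul_inner_lap x x
  have : 0 ≤ ∑ i, ∑ j, A i j * inner ℝ (x i - x j) (x i - x j) :=
    Finset.sum_nonneg fun i _ => Finset.sum_nonneg fun j _ =>
      mul_nonneg (hA.nonneg i j) real_inner_self_nonneg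
  linarith

theorem IsNetwork.eq_of_inner_lap_eq_zero (hA : IsNetwork A) {x : State n k}
    (hx : inner ℝ x (lap A x) = 0) (i j : Fin n) : x i = x j := by
  have h := hA.two_mul_inner_lap x x
  rw [hx, mul_zero] at h
  have hnn : ∀ i j, 0 ≤ A i j * inner ℝ (x i - x j) (x i - x j) := fun i j =>
    mul_nonneg (hA.nonneg i j) real_inner_self_nonneg
  have h0 : ∀ i j, A i j * inner ℝ (x i - x j) (x i - x j) = 0 := fun i j =>
    (Finset.sum_eq_zero_iff_of_nonneg fun j _ => hnn i j).1
      ((Finset.sum_eq_zero_iff_of_nonneg fun i _ => Finset.sum_nonneg fun j _ => hnn i j).1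
        h.symm i (Finset.mem_univ _)) j (Finset.mem_univ _)
  induction hA.connected i j with
  | refl => rfl
  | tail _ hbc ih =>
    rw [ih, ← sub_eq_zero]
    exact inner_self_eq_zero.1 ((mul_eq_zero.1 (h0 _ _)).resolve_left hbc.ne')

theorem IsNetwork.sum_lap (hA : IsNetwork A) (x : State n k) : ∑ i, lap A x i = 0 := by
  have h : ∑ i, lap A x i = -∑ i, lap A x i := by
    simp only [lap_apply]
    nth_rewrite 1 [Finset.sum_comm]
    simp only [← Finset.sum_neg_distrib, ← smul_neg, neg_sub]
    simp only [hA.symm]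
  have h2 : (2 : ℝ) • ∑ i, lap A x i = 0 := by
    rw [two_smul]
    nth_rewrite 1 [h]
    abel
  exact (smul_eq_zero.1 h2).resolve_left two_ne_zero

/-- The state in which all agents are at `c`. -/
noncomputable def consensus (n : ℕ) (c : EuclideanSpace ℝ (Fin k)) : State n k :=
  WithLp.toLp 2 fun _ => c

@[simp]
theorem consensus_apply (c : EuclideanSpace ℝ (Fin k)) (i : Fin n) : consensus n c i = c := rfl

@[simp]
theorem lap_consensus (A : Matrix (Fin n) (Fin n) ℝ) (c : EuclideanSpace ℝ (Fin k)) :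
    lap A (consensus n c) = 0 := by
  ext1 i
  simp [lap_apply]

theorem IsNetwork.norm_lap_sq_le (hA : IsNetwork A) (x : State n k) :
    ‖lap A x‖ ^ 2 ≤ (‖(lap A : State n k →L[ℝ] State n k)‖ + 1) * inner ℝ x (lap A x) := by
  set N := ‖(lap A : State n k →L[ℝ] State n k)‖ with hN
  have hN0 : 0 ≤ N := norm_nonneg _
  -- Nonnegativity of the form at x - (N + 1)⁻¹ Lx, once expanded, gives the bound; N + 1 instead of
  -- N avoids dividing by zero.
  have h1 := hA.inner_lap_nonneg (x - (N + 1)⁻¹ • lap A x)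
  have h2 : inner ℝ (lap A x) (lap A (lap A x)) ≤ N * ‖lap A x‖ ^ 2 := by
    refine (real_inner_le_norm _ _).trans ?_
    have := (lap A : State n k →L[ℝ] State n k).le_opNorm (lap A x)
    nlinarith [norm_nonneg (lap A x)]
  simp only [map_sub, map_smul, inner_sub_left, inner_sub_right, inner_smul_left, inner_smul_right,
    hA.inner_lap_comm x (lap A x), real_inner_self_eq_norm_sq, RCLike.conj_to_real] at h1
  have h3 : (N + 1)⁻¹ * ((N + 1)⁻¹ * inner ℝ (lap A x) (lap A (lap A x))) ≤
      (N + 1)⁻¹ * ‖lap A x‖ ^ 2 := by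
    gcongr
    rw [inv_mul_le_iff₀ (by positivity)]
    nlinarith [sq_nonneg ‖lap A x‖]
  have h4 : (N + 1)⁻¹ * ‖lap A x‖ ^ 2 ≤ inner ℝ x (lap A x) := by
    linarith
  rwa [inv_mul_le_iff₀ (by positivity)] at h4

theorem exists_equiv_of_injective {E : Type*} [NormedAddCommGroup E] [NormedSpace ℝ E]
    [FiniteDimensional ℝ E] (T : E →L[ℝ] E) (hT : Function.Injective T) :
    ∃ e : E ≃L[ℝ] E, ∀ x, e x = T x :=
  ⟨(LinearEquiv.ofInjectiveEndo T.toLinearMap hT).toContinuousLinearEquiv, fun _ => rfl⟩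

/-- The states are parametrized by prescribing `x i` for the agents `i` in a nonempty set and
`(L x) i` for the other agents. -/
theorem IsNetwork.exists_mixedEquiv (hA : IsNetwork A) {C : Finset (Fin n)} (hC : C.Nonempty)
    (k : ℕ) : ∃ T : State n k ≃L[ℝ] State n k,
      ∀ x i, T x i = if i ∈ C then x i else lap A x i := by
  let T : State n k →L[ℝ] State n k :=
    ofAgents fun i => if i ∈ C then agent i else (agent i).comp (lap A)
  have hT : ∀ x i, T x i = if i ∈ C then x i else lap A x i := fun x i => by
    simp only [T, ofAgents_apply]
    split_ifs <;> rfl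
  have hinj : Function.Injective T := by
    refine (injective_iff_map_eq_zero T).2 fun x hx => ?_
    have h : ∀ i, (if i ∈ C then x i else lap A x i) = 0 := fun i => by rw [← hT, hx]; rfl
    -- For every agent either x i or (Lx) i vanishes, so the energy is zero and x is a consensus,
    -- whose value is 0 at any agent of `C`.
    have h0 : inner ℝ x (lap A x) = 0 := by
      rw [PiLp.inner_apply]
      refine Finset.sum_eq_zero fun i _ => ?_
      have := h i
      split_ifs at this with hi <;> simp [this]
    obtain ⟨i, hi⟩ := hC
    ext1 j
    rw [hA.eq_of_inner_lap_eq_zero h0 j i]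
    simpa [hi] using h i
  obtain ⟨e, he⟩ := exists_equiv_of_injective T hinj
  exact ⟨e, fun x i => by rw [he, hT]⟩

/-- A spectral gap without eigenvalues. Translating so that agent `i₀` sits at 0 changes neither
side; then T v is made of blocks of Lx and one zero block, and T is invertible. -/
theorem IsNetwork.exists_inner_lap_le (hA : IsNetwork A) (k : ℕ) :
    ∃ c : ℝ, 0 < c ∧ ∀ x : State n k, inner ℝ x (lap A x) ≤ c * ‖lap A x‖ ^ 2 := by
  rcases isEmpty_or_nonempty (Fin n) with hn | ⟨⟨i₀⟩⟩
  · exact ⟨1, one_pos, fun x => by simp [PiLp.inner_apply]⟩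
  obtain ⟨T, hT⟩ := hA.exists_mixedEquiv (Finset.singleton_nonempty i₀) k
  refine ⟨‖(T.symm : State n k →L[ℝ] State n k)‖ + 1, by positivity, fun x => ?_⟩
  set v := x - consensus n (x i₀) with hv
  have hLv : lap A v = lap A x := by simp [hv]
  have h1 : inner ℝ x (lap A x) = inner ℝ v (lap A x) := by
    rw [hv, inner_sub_left, hA.inner_lap_comm (consensus n (x i₀))]
    simp
  have h2 : ‖T v‖ ≤ ‖lap A x‖ := by
    rw [PiLp.norm_eq_of_L2, PiLp.norm_eq_of_L2]
    refine Real.sqrt_le_sqrt (Finset.sum_le_sum fun i _ => ?_)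
    gcongr
    rw [hT, hLv]
    split_ifs with hi
    · rw [Finset.mem_singleton.1 hi]
      simp [hv]
    · exact le_rfl
  have h3 := (T.symm : State n k →L[ℝ] State n k).le_opNorm (T v)
  simp only [ContinuousLinearEquiv.coe_coe, ContinuousLinearEquiv.symm_apply_apply] at h3
  rw [h1]
  calc _ ≤ ‖v‖ * ‖lap A x‖ := real_inner_le_norm _ _
    _ ≤ (‖(T.symm : State n k →L[ℝ] State n k)‖ * ‖T v‖) * ‖lap A x‖ := by gcongr
    _ ≤ ((‖(T.symm : State n k →L[ℝ] State n k)‖ + 1) * ‖lap A x‖) * ‖lap A x‖ := by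
        gcongr
        linarith
    _ = _ := by ring

end Network

/-! ### Maximal solutions -/

section Maximal

variable {E : Type*} [NormedAddCommGroup E] [NormedSpace ℝ E] [MeasureSpace E] {g : E → E}

theorem IsFilippovSolution.of_lipschitz {X : ℝ → E} {K : ℝ≥0} (hX : LipschitzWith K X)
    (h : ∀ᵐ t : ℝ, 0 ≤ t → ∃ v ∈ filippovMap g (X t), HasDerivAt X v t) :
    IsFilippovSolution g (Ici 0) X where
  ordConnected := ordConnected_Ici
  zero_mem := self_mem_Ici
  nonneg _ ht := ht
  absolutelyContinuous _ _ := hX.lipschitzOnWith.absolutelyContinuousOnInterval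
  hasDerivAt := h

theorem IsFilippovSolution.isMaximal_Ici {X : ℝ → E} (hX : IsFilippovSolution g (Ici 0) X) :
    IsMaximalFilippovSolution g (Ici 0) X :=
  ⟨hX, fun _ _ hy hJ _ => Subset.antisymm hy.nonneg hJ⟩

theorem IsFilippovSolution.absolutelyContinuous_of_le {J : Set ℝ} {x : ℝ → E}
    (hx : IsFilippovSolution g J x) {a b : ℝ} (ha : 0 ≤ a) (hab : a ≤ b) (hb : b ∈ J) :
    AbsolutelyContinuousOnInterval x a b :=
  (hx.absolutelyContinuous b hb).mono (by
    rw [uIcc_of_le hab, uIcc_of_le (ha.trans hab)]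
    exact Icc_subset_Icc_left ha)

theorem IsFilippovSolution.mem_of_le {J : Set ℝ} {x : ℝ → E} (hx : IsFilippovSolution g J x)
    {a b : ℝ} (ha : 0 ≤ a) (hab : a ≤ b) (hb : b ∈ J) : a ∈ J :=
  hx.ordConnected.out hx.zero_mem hb ⟨ha, hab⟩

/-- The vector field has a local Lipschitz Filippov solution from every initial state. -/
def LocallySolvable (g : E → E) : Prop :=
  ∀ x₀ : E, ∃ τ : ℝ, 0 < τ ∧ ∃ (X : ℝ → E) (K : ℝ≥0), LipschitzWith K X ∧ X 0 = x₀ ∧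
    ∀ᵐ t : ℝ, t ∈ Icc 0 τ → ∃ v ∈ filippovMap g (X t), HasDerivAt X v t

/-- A Lipschitz solution on a bounded time interval is not maximal if there are local solutions
from all initial states. -/
theorem IsMaximalFilippovSolution.eq_Ici [FiniteDimensional ℝ E] {J : Set ℝ} {x : ℝ → E}
    (hx : IsMaximalFilippovSolution g J x) {K : ℝ≥0} (hK : LipschitzOnWith K x J)
    (hloc : LocallySolvable g) : J = Ici 0 := by
  obtain ⟨hs, hmax⟩ := hx
  by_cases hb : BddAbove J
  swap
  · refine Subset.antisymm hs.nonneg fun t ht => ?_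
    obtain ⟨s, hs', hts⟩ := not_bddAbove_iff.1 hb t
    exact hs.mem_of_le ht hts.le hs'
  exfalso
  set T := sSup J with hT
  have hT0 : 0 ≤ T := le_csSup hb hs.zero_mem
  -- The Lipschitz extension supplies a value at `T` even when `T ∉ J`.
  obtain ⟨z, hz, hxz⟩ := hK.extend_finite_dimension
  obtain ⟨τ, hτ, X, M, hX, hX0, hXd⟩ := hloc (z T)
  -- Concatenation of `z` up to `T` with `X` started at time `T`; in this form it is visibly
  -- Lipschitz.
  let y : ℝ → E := fun t => z (min t T) + (X (max (t - T) 0) - z T)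
  have hy1 : ∀ t, t ≤ T → y t = z t := fun t ht => by
    simp [y, min_eq_left ht, max_eq_right (sub_nonpos.2 ht), hX0]
  have hy2 : ∀ t, T ≤ t → y t = X (t - T) := fun t ht => by
    simp [y, min_eq_right ht, max_eq_left (sub_nonneg.2 ht)]
  have hylip : LipschitzWith _ y := (hz.comp (LipschitzWith.id.min_const T)).add
    ((hX.comp (((LipschitzWith.id).sub (LipschitzWith.const T)).max_const 0)).sub
      (LipschitzWith.const (z T)))
  have hyJ : EqOn x y J := fun t ht => by rw [hy1 t (le_csSup hb ht)]; exact hxz ht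
  have hmem : ∀ t, 0 ≤ t → t < T → t ∈ J := fun t ht htT => by
    obtain ⟨s, hsJ, hts⟩ := exists_lt_of_lt_csSup ⟨0, hs.zero_mem⟩ htT
    exact hs.mem_of_le ht hts.le hsJ
  have hsol : IsFilippovSolution g (Icc 0 (T + τ)) y := by
    refine ⟨ordConnected_Icc, ⟨le_rfl, by linarith⟩, fun t ht => ht.1,
      fun t _ => hylip.lipschitzOnWith.absolutelyContinuousOnInterval, ?_⟩
    have hshift : ∀ᵐ t : ℝ, t - T ∈ Icc 0 τ →
        ∃ v ∈ filippovMap g (X (t - T)), HasDerivAt X v (t - T) :=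
      (measurePreserving_sub_right volume T).quasiMeasurePreserving.ae hXd
    filter_upwards [hs.hasDerivAt, hshift, Measure.ae_ne volume 0, Measure.ae_ne volume T]
      with t h1 h2 ht0 htT ht
    rcases lt_or_gt_of_ne htT with hlt | hgt
    · obtain ⟨v, hv, hd⟩ := h1 (hmem t ht.1 hlt)
      have hev : y =ᶠ[𝓝 t] x := by
        filter_upwards [Ioo_mem_nhds (lt_of_le_of_ne ht.1 ht0.symm) hlt] with s hs'
        exact (hyJ (hmem s hs'.1.le hs'.2)).symm
      exact ⟨v, by rwa [hev.eq_of_nhds], hd.congr_of_eventuallyEq hev⟩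
    · obtain ⟨v, hv, hd⟩ := h2 ⟨by linarith, by linarith [ht.2]⟩
      have hev : y =ᶠ[𝓝 t] fun s => X (s - T) := by
        filter_upwards [lt_mem_nhds hgt] with s hs'
        exact hy2 s hs'.le
      exact ⟨v, by rwa [hev.eq_of_nhds], (hd.comp_sub_const t T).congr_of_eventuallyEq hev⟩
  have hJJ := hmax _ y hsol (fun t ht => ⟨hs.nonneg t ht, by linarith [le_csSup hb ht]⟩) hyJ
  have : T + τ ∈ J := hJJ ▸ ⟨by linarith, le_rfl⟩
  linarith [le_csSup hb this]

end Maximal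

/-! ### Energy estimates along Filippov solutions -/

section General

variable {E : Type*} [NormedAddCommGroup E]

theorem hasDerivAt_inner_clm [InnerProductSpace ℝ E] (L : E →L[ℝ] E)
    (hL : ∀ x z, inner ℝ x (L z) = inner ℝ (L x) z) {x : ℝ → E} {v : E} {t : ℝ}
    (hx : HasDerivAt x v t) :
    HasDerivAt (fun s => inner ℝ (x s) (L (x s))) (2 * inner ℝ (L (x t)) v) t := by
  have h := hx.inner ℝ (L.hasFDerivAt.comp_hasDerivAt t hx)
  refine h.congr_deriv ?_
  simp only [Function.comp_apply]
  rw [hL, real_inner_comm (L (x t)) v]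
  ring

theorem absolutelyContinuous_inner_clm [InnerProductSpace ℝ E] [FiniteDimensional ℝ E]
    (L : E →L[ℝ] E) {x : ℝ → E} {a b : ℝ} (hx : AbsolutelyContinuousOnInterval x a b) :
    AbsolutelyContinuousOnInterval (fun s => inner ℝ (x s) (L (x s))) a b := by
  have : ProperSpace E := FiniteDimensional.proper ℝ E
  obtain ⟨C, hC⟩ := hx.exists_bound
  have h : ContDiff ℝ 1 (fun z : E => inner ℝ z (L z)) := contDiff_id.inner ℝ L.contDiff
  obtain ⟨K, hK⟩ := h.contDiffOn.exists_lipschitzOnWith one_ne_zero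
    (convex_closedBall (0 : E) C) (isCompact_closedBall _ _)
  refine absolutelyContinuous_lipschitz_comp (φ := fun z : E => inner ℝ z (L z)) (hK.mono ?_) hx
  rintro _ ⟨t, ht, rfl⟩
  simpa using hC t ht

/-- Cutting the field off outside `U` makes it bounded. For a short time the global solution of the
truncated field stays in `U`, where the two fields coincide. -/
theorem locallySolvable_of_locallyBounded [NormedSpace ℝ E] [FiniteDimensional ℝ E]
    [MeasureSpace E] [(volume : Measure E).IsOpenPosMeasure] {g : E → E}
    (h : ∀ x₀ : E, ∃ U : Set E, IsOpen U ∧ x₀ ∈ U ∧ ∃ M : ℝ, ∀ z ∈ U, ‖g z‖ ≤ M) :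
    LocallySolvable g := by
  classical
  intro x₀
  obtain ⟨U, hU, hx₀, M, hM⟩ := h x₀
  let g' : E → E := fun z => if z ∈ U then g z else 0
  have hg : ∀ z, ‖g' z‖ ≤ M := fun z => by
    by_cases hz : z ∈ U
    · simpa only [g', if_pos hz] using hM z hz
    · simpa [g', if_neg hz] using (norm_nonneg _).trans (hM x₀ hx₀)
  obtain ⟨X, hX, hX0, hXd⟩ := exists_lipschitz_filippov_solution hg x₀
  have hev : ∀ᶠ t in 𝓝 (0 : ℝ), X t ∈ U := by
    refine hX.continuous.continuousAt.eventually_mem (hU.mem_nhds ?_)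
    rwa [hX0]
  obtain ⟨ε, hε, hball⟩ := Metric.eventually_nhds_iff_ball.1 hev
  refine ⟨ε / 2, by positivity, X, _, hX, hX0, ?_⟩
  filter_upwards [hXd] with t ht htε
  obtain ⟨v, hv, hd⟩ := ht htε.1
  refine ⟨v, filippovMap_subset_of_eventuallyEq ?_ hv, hd⟩
  have hXt : X t ∈ U := hball t (by
    rw [Metric.mem_ball, Real.dist_0_eq_abs, abs_of_nonneg htε.1]
    linarith [htε.2])
  filter_upwards [hU.mem_nhds hXt] with z hz
  exact if_pos hz

variable [InnerProductSpace ℝ E] [MeasureSpace E] {g : E → E} {J : Set ℝ} {x : ℝ → E}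

theorem IsFilippovSolution.norm_sub_le (hx : IsFilippovSolution g J x) {a b M : ℝ} (ha : 0 ≤ a)
    (hab : a ≤ b) (hb : b ∈ J) (h : ∀ t ∈ Ioo a b, ∀ v ∈ filippovMap g (x t), ‖v‖ ≤ M) :
    ‖x b - x a‖ ≤ M * (b - a) := by
  refine norm_sub_le_mul_of_ae_deriv_le hab (hx.absolutelyContinuous_of_le ha hab hb) ?_
  filter_upwards [hx.hasDerivAt] with t ht htab
  obtain ⟨v, hv, hd⟩ := ht (hx.mem_of_le (ha.trans htab.1.le) htab.2.le hb)
  exact ⟨v, h t htab v hv, hd⟩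

theorem IsFilippovSolution.clm_eq {F : Type*} [NormedAddCommGroup F] [InnerProductSpace ℝ F]
    (hx : IsFilippovSolution g J x) (P : E →L[ℝ] F) {a b : ℝ} (ha : 0 ≤ a)
    (hab : a ≤ b) (hb : b ∈ J) (h : ∀ t ∈ Ioo a b, ∀ v ∈ filippovMap g (x t), P v = 0) :
    P (x b) = P (x a) := by
  have := norm_sub_le_mul_of_ae_deriv_le (f := fun t => P (x t)) (M := 0) hab
    (absolutelyContinuous_clm_comp P (hx.absolutelyContinuous_of_le ha hab hb)) (by
      filter_upwards [hx.hasDerivAt] with t ht htab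
      obtain ⟨v, hv, hd⟩ := ht (hx.mem_of_le (ha.trans htab.1.le) htab.2.le hb)
      exact ⟨P v, by rw [h t htab v hv, norm_zero], P.hasFDerivAt.comp_hasDerivAt t hd⟩)
  rw [zero_mul] at this
  exact sub_eq_zero.1 (norm_eq_zero.1 (le_antisymm this (norm_nonneg _)))

theorem IsMaximalFilippovSolution.eq_Ici_of_bounded [FiniteDimensional ℝ E]
    (hx : IsMaximalFilippovSolution g J x) {M : ℝ} (hM : 0 ≤ M)
    (h : ∀ t ∈ J, ∀ v ∈ filippovMap g (x t), ‖v‖ ≤ M) (hloc : LocallySolvable g) :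
    J = Ici 0 := by
  have hle : ∀ a ∈ J, ∀ b ∈ J, a ≤ b → ‖x b - x a‖ ≤ M * (b - a) := fun a ha b hb hab =>
    hx.1.norm_sub_le (hx.1.nonneg a ha) hab hb fun t ht =>
      h t (hx.1.ordConnected.out ha hb (Ioo_subset_Icc_self ht))
  refine hx.eq_Ici (K := M.toNNReal) (LipschitzOnWith.of_dist_le_mul fun a ha b hb => ?_) hloc
  rw [Real.coe_toNNReal _ hM]
  rcases le_total a b with hab | hab
  · rw [dist_comm, dist_eq_norm, Real.dist_eq, abs_sub_comm, abs_of_nonneg (sub_nonneg.2 hab)]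
    exact hle a ha b hb hab
  · rw [dist_eq_norm, Real.dist_eq, abs_of_nonneg (sub_nonneg.2 hab)]
    exact hle b hb a ha hab

variable [FiniteDimensional ℝ E] {L : E →L[ℝ] E}

theorem IsFilippovSolution.inner_clm_le (hL : ∀ x z, inner ℝ x (L z) = inner ℝ (L x) z)
    (hx : IsFilippovSolution g J x) {a b : ℝ} (ha : 0 ≤ a) (hab : a ≤ b) (hb : b ∈ J)
    (h : ∀ t ∈ Ioo a b, ∀ v ∈ filippovMap g (x t), inner ℝ (L (x t)) v ≤ 0) :
    inner ℝ (x b) (L (x b)) ≤ inner ℝ (x a) (L (x a)) := by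
  have := sub_le_mul_of_ae_deriv_le (c := 0) hab
    (absolutelyContinuous_inner_clm L (hx.absolutelyContinuous_of_le ha hab hb)) (by
      filter_upwards [hx.hasDerivAt] with t ht htab
      obtain ⟨v, hv, hd⟩ := ht (hx.mem_of_le (ha.trans htab.1.le) htab.2.le hb)
      refine ⟨_, ?_, hasDerivAt_inner_clm L hL hd⟩
      linarith [h t htab v hv])
  linarith

/-- The derivative of √V is ⟨Lx, v⟩/√V ≤ -c. Monotonicity keeps V in [V T, V 0], away from 0, where
the square root is Lipschitz and √V remains absolutely continuous. -/
theorem IsFilippovSolution.sqrt_inner_clm_le (hL : ∀ x z, inner ℝ x (L z) = inner ℝ (L x) z)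
    (hx : IsFilippovSolution g J x) {c : ℝ} (hc : 0 ≤ c)
    (h : ∀ x v, v ∈ filippovMap g x → inner ℝ (L x) v ≤ -(c * √(inner ℝ x (L x))))
    {T : ℝ} (hT : T ∈ J) (hpos : 0 < inner ℝ (x T) (L (x T))) :
    c * T ≤ √(inner ℝ (x 0) (L (x 0))) := by
  set V : ℝ → ℝ := fun t => inner ℝ (x t) (L (x t)) with hV
  have hT0 := hx.nonneg T hT
  have hanti : ∀ a b, 0 ≤ a → a ≤ b → b ∈ J → V b ≤ V a := fun a b ha hab hb =>
    hx.inner_clm_le hL ha hab hb fun t _ v hv => (h _ v hv).trans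
      (neg_nonpos.2 (mul_nonneg hc (Real.sqrt_nonneg _)))
  have hbd : ∀ t ∈ uIcc 0 T, V t ∈ Icc (V T) (V 0) := fun t ht => by
    rw [uIcc_of_le hT0] at ht
    exact ⟨hanti t T ht.1 ht.2 hT, hanti 0 t le_rfl ht.1 (hx.mem_of_le ht.1 ht.2 hT)⟩
  have hcd : ContDiffOn ℝ 1 Real.sqrt (Icc (V T) (V 0)) := fun r hr =>
    (Real.contDiffAt_sqrt (hpos.trans_le hr.1).ne').contDiffWithinAt
  obtain ⟨K, hK⟩ := hcd.exists_lipschitzOnWith one_ne_zero (convex_Icc _ _) isCompact_Icc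
  have hac : AbsolutelyContinuousOnInterval (fun t => √(V t)) 0 T :=
    absolutelyContinuous_lipschitz_comp (hK.mono (by rintro _ ⟨t, ht, rfl⟩; exact hbd t ht))
      (absolutelyContinuous_inner_clm L (hx.absolutelyContinuous T hT))
  have := sub_le_mul_of_ae_deriv_le (c := -c) hT0 hac (by
    filter_upwards [hx.hasDerivAt] with t ht htab
    obtain ⟨v, hv, hd⟩ := ht (hx.mem_of_le htab.1.le htab.2.le hT)
    have hVt : 0 < V t :=
      hpos.trans_le (hbd t (by rw [uIcc_of_le hT0]; exact Ioo_subset_Icc_self htab)).1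
    refine ⟨_, ?_, (hasDerivAt_inner_clm L hL hd).sqrt hVt.ne'⟩
    have hs := Real.sqrt_pos.2 hVt
    rw [div_le_iff₀ (by positivity)]
    have := h _ v hv
    linarith)
  have h0 := Real.sqrt_nonneg (V T)
  simp only [sub_zero] at this
  linarith

end General

/-! ### The closed loop -/

section ClosedLoop

variable {n k : ℕ} {p : ℝ≥0∞} [Fact (1 ≤ p)] {G : SimpleGraph (Fin n)}
  {w : Fin n → Fin n → ℝ} {Ic : Finset (Fin n)}
  {f : Fin n → EuclideanSpace ℝ (Fin k) → EuclideanSpace ℝ (Fin k)}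

theorem norm_le_sum_norm_apply (v : State n k) : ‖v‖ ≤ ∑ i, ‖v i‖ := by
  rw [PiLp.norm_eq_of_L2]
  refine Real.sqrt_le_iff.2 ⟨by positivity, ?_⟩
  exact Finset.sum_sq_le_sq_sum_of_nonneg fun i _ => norm_nonneg _

theorem IsAdmissible.exists_bound (hf : IsAdmissible p Ic f) (R : ℝ) :
    ∃ M : ℝ, 0 ≤ M ∧ ∀ z, ‖lap (adjacency G w) z‖ ≤ R → ‖closedLoop G w f z‖ ≤ M := by
  have h : ∀ i, ∃ m : ℝ, ∀ y, ‖y‖ ≤ R → ‖f i y‖ ≤ m := fun i => by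
    by_cases hi : i ∈ Ic
    · obtain ⟨m, hm⟩ := (isCompact_closedBall (0 : EuclideanSpace ℝ (Fin k)) R).exists_bound_of_continuousOn
        (hf.continuous_agents i hi).locallyLipschitz.continuous.continuousOn
      exact ⟨m, fun y hy => hm y (by simpa using hy)⟩
    · obtain ⟨c, -, hc⟩ := exists_norm_dirSign_le p k
      exact ⟨c, fun y _ => by rw [hf.signum_agents i hi]; exact hc y⟩
  choose m hm using h
  refine ⟨|∑ i, m i|, abs_nonneg _, fun z hz => (norm_le_sum_norm_apply _).trans
    ((Finset.sum_le_sum fun i _ => ?_).trans (le_abs_self _))⟩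
  rw [closedLoop_eq]
  refine hm i _ ?_
  rw [norm_neg]
  exact (PiLp.norm_apply_le _ i).trans hz

theorem continuousAt_closedLoop_apply {x : State n k} {i : Fin n}
    (h : ContinuousAt (f i) (-lap (adjacency G w) x i)) :
    ContinuousAt (fun z => closedLoop G w f z i) x := by
  simp only [closedLoop_eq]
  refine ContinuousAt.comp (g := f i) h (Continuous.continuousAt ?_)
  exact (((agent i).continuous).comp (lap (adjacency G w)).continuous).neg

theorem IsAdmissible.continuousAt (hf : IsAdmissible p Ic f) {i : Fin n}
    {y : EuclideanSpace ℝ (Fin k)} (h : i ∈ Ic ∨ y ≠ 0) : ContinuousAt (f i) y := by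
  by_cases hi : i ∈ Ic
  · exact (hf.continuous_agents i hi).locallyLipschitz.continuous.continuousAt
  · rw [hf.signum_agents i hi]
    exact continuousAt_dirSign p (h.resolve_left hi)

theorem IsAdmissible.apply_eq_of_mem (hf : IsAdmissible p Ic f) {x v : State n k} {i : Fin n}
    (hv : v ∈ filippovMap (closedLoop G w f) x) (h : i ∈ Ic ∨ lap (adjacency G w) x i ≠ 0) :
    v i = f i (-lap (adjacency G w) x i) := by
  rw [← closedLoop_eq G w f]
  exact clm_eq_of_mem_filippovMap (agent i)
    (continuousAt_closedLoop_apply (hf.continuousAt (h.imp_right neg_ne_zero.2))) hv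

/-- A signum agent with (Lx) i = 0 has an undetermined velocity, but its term in the inner product
vanishes anyway. -/
theorem IsAdmissible.exists_inner_lap_le (hf : IsAdmissible p Ic f) :
    ∃ c : ℝ, 0 < c ∧ ∀ x v : State n k, v ∈ filippovMap (closedLoop G w f) x →
      inner ℝ (lap (adjacency G w) x) v ≤ -(c * ∑ i ∈ Icᶜ, ‖lap (adjacency G w) x i‖) := by
  obtain ⟨c, hc, hcy⟩ := exists_le_inner_dirSign p k
  refine ⟨c, hc, fun x v hv => ?_⟩
  rw [PiLp.inner_apply, ← Finset.sum_add_sum_compl Ic, Finset.mul_sum, ← Finset.sum_neg_distrib]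
  have h1 : ∑ i ∈ Ic, inner ℝ (lap (adjacency G w) x i) (v i) ≤ 0 := by
    refine Finset.sum_nonpos fun i hi => ?_
    rw [hf.apply_eq_of_mem hv (Or.inl hi)]
    rcases eq_or_ne (-lap (adjacency G w) x i) 0 with h0 | h0
    · rw [neg_eq_zero.1 h0]
      simp
    · have := (hf.continuous_agents i hi).inner_pos _ h0
      rw [inner_neg_right, real_inner_comm] at this
      linarith
  have h2 : ∑ i ∈ Icᶜ, inner ℝ (lap (adjacency G w) x i) (v i) ≤
      ∑ i ∈ Icᶜ, -(c * ‖lap (adjacency G w) x i‖) := by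
    refine Finset.sum_le_sum fun i hi => ?_
    rcases eq_or_ne (lap (adjacency G w) x i) 0 with h0 | h0
    · simp [h0]
    · rw [hf.apply_eq_of_mem hv (Or.inr h0), hf.signum_agents i (Finset.mem_compl.1 hi),
        dirSign_neg, inner_neg_right]
      exact neg_le_neg (hcy _)
  linarith

theorem IsAdmissible.inner_lap_nonpos (hf : IsAdmissible p Ic f) {x v : State n k}
    (hv : v ∈ filippovMap (closedLoop G w f) x) : inner ℝ (lap (adjacency G w) x) v ≤ 0 := by
  obtain ⟨c, hc, h⟩ := hf.exists_inner_lap_le (G := G) (w := w)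
  refine (h x v hv).trans (neg_nonpos.2 ?_)
  positivity

theorem IsAdmissible.locallySolvable (hf : IsAdmissible p Ic f) :
    LocallySolvable (closedLoop G w f) := by
  refine locallySolvable_of_locallyBounded fun x₀ => ?_
  obtain ⟨M, -, hMz⟩ := hf.exists_bound (G := G) (w := w) (‖lap (adjacency G w) x₀‖ + 1)
  have hU : IsOpen {z : State n k | ‖lap (adjacency G w) z‖ < ‖lap (adjacency G w) x₀‖ + 1} :=
    isOpen_lt (lap (adjacency G w)).continuous.norm continuous_const
  exact ⟨_, hU, by simp, M, fun z hz => hMz z (le_of_lt hz)⟩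

theorem IsAdmissible.eq_Ici_of_isMaximal (hf : IsAdmissible p Ic f)
    (hA : IsNetwork (adjacency G w)) {J : Set ℝ} {x : ℝ → State n k}
    (hx : IsMaximalFilippovSolution (closedLoop G w f) J x) : J = Ici 0 := by
  set A := adjacency G w with hAdef
  set R := √((‖(lap A : State n k →L[ℝ] State n k)‖ + 1) * inner ℝ (x 0) (lap A (x 0))) with hR
  have hlap : ∀ t ∈ J, ‖lap A (x t)‖ ≤ R := fun t ht => by
    refine Real.le_sqrt_of_sq_le ((hA.norm_lap_sq_le (x t)).trans ?_)
    gcongr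
    exact hx.1.inner_clm_le hA.inner_lap_comm le_rfl (hx.1.nonneg t ht) ht
      fun _ _ _ hv => hf.inner_lap_nonpos hv
  -- The margin 1 is needed because the Filippov map also sees states near `x t`.
  obtain ⟨M, hM, hMz⟩ := hf.exists_bound (G := G) (w := w) (R + 1)
  refine hx.eq_Ici_of_bounded hM (fun t ht v hv => ?_) hf.locallySolvable
  have h1 : ∀ᶠ z in 𝓝 (x t), ‖lap A z‖ < R + 1 :=
    ((lap A).continuous.norm.continuousAt).eventually_lt_const ((hlap t ht).trans_lt (lt_add_one _))
  have := clm_mem_of_mem_filippovMap (ContinuousLinearMap.id ℝ (State n k))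
    (Metric.isClosed_closedBall (x := (0 : State n k)) (ε := M)) (convex_closedBall _ _)
    (h1.mono fun z hz => by simpa using hMz z hz.le) hv
  simpa using this

end ClosedLoop

/-! ### Finite-time consensus with at most one continuous agent -/

section Convergence

variable {n k : ℕ} {p : ℝ≥0∞} [Fact (1 ≤ p)] {G : SimpleGraph (Fin n)}
  {w : Fin n → Fin n → ℝ} {Ic : Finset (Fin n)}
  {f : Fin n → EuclideanSpace ℝ (Fin k) → EuclideanSpace ℝ (Fin k)}

/-- The blocks of Lx sum to zero, so a single missing block is minus the sum of the others. -/
theorem IsNetwork.norm_lap_le_of_card_le_one {A : Matrix (Fin n) (Fin n) ℝ} (hA : IsNetwork A)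
    {C : Finset (Fin n)} (hC : C.card ≤ 1) (x : State n k) :
    ‖lap A x‖ ≤ 2 * ∑ i ∈ Cᶜ, ‖lap A x i‖ := by
  refine (norm_le_sum_norm_apply _).trans ?_
  rw [← Finset.sum_add_sum_compl C, two_mul]
  refine add_le_add_left ?_ _
  rcases C.eq_empty_or_nonempty with rfl | hne
  · simp only [Finset.sum_empty]
    positivity
  · obtain ⟨i, rfl⟩ := Finset.card_eq_one.1 (le_antisymm hC hne.card_pos)
    have h := hA.sum_lap x
    rw [← Finset.sum_add_sum_compl {i}, Finset.sum_singleton] at h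
    rw [Finset.sum_singleton, eq_neg_of_add_eq_zero_left h, norm_neg]
    exact norm_sum_le _ _

theorem IsAdmissible.exists_inner_lap_le_sqrt (hf : IsAdmissible p Ic f)
    (hA : IsNetwork (adjacency G w)) (hcard : Ic.card ≤ 1) :
    ∃ c : ℝ, 0 < c ∧ ∀ x v : State n k, v ∈ filippovMap (closedLoop G w f) x →
      inner ℝ (lap (adjacency G w) x) v ≤ -(c * √(inner ℝ x (lap (adjacency G w) x))) := by
  obtain ⟨c₁, hc₁, h₁⟩ := hf.exists_inner_lap_le (G := G) (w := w)
  obtain ⟨c₂, hc₂, h₂⟩ := hA.exists_inner_lap_le k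
  refine ⟨c₁ / (2 * √c₂), by positivity, fun x v hv => (h₁ x v hv).trans (neg_le_neg ?_)⟩
  have h3 := hA.norm_lap_le_of_card_le_one hcard x
  have h4 : √(inner ℝ x (lap (adjacency G w) x)) ≤ √c₂ * ‖lap (adjacency G w) x‖ := by
    rw [Real.sqrt_le_left (by positivity), mul_pow, Real.sq_sqrt hc₂.le]
    exact h₂ x
  have h5 : 0 < √c₂ := Real.sqrt_pos.2 hc₂
  calc _ ≤ c₁ / (2 * √c₂) * (√c₂ * (2 * ∑ i ∈ Icᶜ, ‖lap (adjacency G w) x i‖)) := by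
        gcongr
        exact h4.trans (by gcongr)
    _ = _ := by field

theorem IsNetwork.eq_consensus {A : Matrix (Fin n) (Fin n) ℝ} (hA : IsNetwork A) {x : State n k}
    (hx : inner ℝ x (lap A x) = 0) (i : Fin n) : x = consensus n (x i) := by
  ext1 j
  exact hA.eq_of_inner_lap_eq_zero hx j i

/-- `P` is constant once consensus is reached, and it determines the consensus value because `r ≠
0`. -/
theorem IsAdmissible.finiteTimeStaticConsensus (hf : IsAdmissible p Ic f)
    (hA : IsNetwork (adjacency G w)) (hcard : Ic.card ≤ 1)
    (P : State n k →L[ℝ] EuclideanSpace ℝ (Fin k)) {r : ℝ} (hr : r ≠ 0)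
    (hPc : ∀ c, P (consensus n c) = r • c)
    (hP : ∀ c, ∀ v ∈ filippovMap (closedLoop G w f) (consensus n c), P v = 0) :
    FiniteTimeStaticConsensus (closedLoop G w f) := by
  intro J x hx
  have hJ := hf.eq_Ici_of_isMaximal hA hx
  refine ⟨hJ, ?_⟩
  have hxs := hx.1
  rw [hJ] at hxs
  obtain ⟨c, hc, h⟩ := hf.exists_inner_lap_le_sqrt (G := G) (w := w) hA hcard
  -- The summand 1 makes `T` positive and c T strictly larger than √V(0), so positive energy after
  -- `T` is contradictory.
  set T := √(inner ℝ (x 0) (lap (adjacency G w) (x 0))) / c + 1 with hT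
  have hT0 : 0 < T := by positivity
  have hzero : ∀ t, T ≤ t → inner ℝ (x t) (lap (adjacency G w) (x t)) = 0 := fun t ht => by
    by_contra hne
    have h1 := hxs.sqrt_inner_clm_le hA.inner_lap_comm hc.le h (hT0.le.trans ht)
      (lt_of_le_of_ne (hA.inner_lap_nonneg (x t)) (Ne.symm hne))
    have h2 : c * T ≤ c * t := by gcongr
    have h3 : c * T = √(inner ℝ (x 0) (lap (adjacency G w) (x 0))) + c := by
      rw [hT]
      field
    linarith
  refine ⟨T, hT0, r⁻¹ • P (x T), fun t ht i => ?_⟩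
  have h4 : P (x t) = P (x T) := hxs.clm_eq P hT0.le ht (hT0.le.trans ht) fun s hs v hv => by
    rw [hA.eq_consensus (hzero s hs.1.le) i] at hv
    exact hP _ v hv
  rw [← h4, hA.eq_consensus (hzero t ht) i, hPc, smul_smul, inv_mul_cancel₀ hr, one_smul,
    consensus_apply]

theorem IsAdmissible.finiteTimeStaticConsensus_of_card_eq_one (hf : IsAdmissible p Ic f)
    (hA : IsNetwork (adjacency G w)) (hcard : Ic.card = 1) :
    FiniteTimeStaticConsensus (closedLoop G w f) := by
  obtain ⟨i, rfl⟩ := Finset.card_eq_one.1 hcard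
  have hi := Finset.mem_singleton_self i
  refine hf.finiteTimeStaticConsensus hA hcard.le (agent i) one_ne_zero (fun c => by simp)
    fun c v hv => ?_
  rw [agent_apply, hf.apply_eq_of_mem hv (Or.inl hi), lap_consensus, PiLp.zero_apply, neg_zero,
    (hf.continuous_agents i hi).map_zero]

theorem IsAdmissible.finiteTimeStaticConsensus_of_two {G : SimpleGraph (Fin 2)}
    {w : Fin 2 → Fin 2 → ℝ} {f : Fin 2 → EuclideanSpace ℝ (Fin k) → EuclideanSpace ℝ (Fin k)}
    (hf : IsAdmissible p ∅ f) (hA : IsNetwork (adjacency G w)) :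
    FiniteTimeStaticConsensus (closedLoop G w f) := by
  -- The two inputs are opposite and the signum is odd, so the velocities cancel at every state.
  have h0 : ∀ z, (agent 0 + agent 1 : State 2 k →L[ℝ] _) (closedLoop G w f z) = 0 := fun z => by
    have h := hA.sum_lap z
    rw [Fin.sum_univ_two] at h
    simp only [add_apply, agent_apply, closedLoop_eq,
      hf.signum_agents _ (Finset.notMem_empty _)]
    rw [eq_neg_of_add_eq_zero_left h, dirSign_neg, dirSign_neg]
    abel
  refine hf.finiteTimeStaticConsensus hA (by simp) (agent 0 + agent 1) two_ne_zero
    (fun c => by simp [two_smul]) fun c v hv => ?_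
  rw [clm_eq_of_mem_filippovMap (agent 0 + agent 1) (by simp only [h0]; exact continuousAt_const)
    hv, h0]

end Convergence

/-! ### Rays, continuous fields and equilibria not reached in finite time -/

section General

variable {E : Type*} [NormedAddCommGroup E]

theorem IsFilippovSolution.of_subset [NormedSpace ℝ E] [MeasureSpace E] {g g' : E → E}
    {x : ℝ → E} (hx : IsFilippovSolution g (Ici 0) x)
    (h : ∀ t, 0 ≤ t → filippovMap g (x t) ⊆ filippovMap g' (x t)) :
    IsFilippovSolution g' (Ici 0) x := by
  refine ⟨hx.1, hx.2, hx.3, hx.4, ?_⟩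
  filter_upwards [hx.hasDerivAt] with t ht ht0
  obtain ⟨v, hv, hd⟩ := ht ht0
  exact ⟨v, h t ht0 hv, hd⟩

theorem isFilippovSolution_smul [NormedSpace ℝ E] [MeasureSpace E] {g : E → E} {e : E}
    (h : ∀ t : ℝ, e ∈ filippovMap g (t • e)) :
    IsFilippovSolution g (Ici 0) fun t : ℝ => t • e := by
  have hlip : LipschitzWith ‖e‖₊ fun t : ℝ => t • e :=
    LipschitzWith.of_dist_le_mul fun a b => by
      rw [dist_eq_norm, ← sub_smul, norm_smul, Real.dist_eq, coe_nnnorm, mul_comm, Real.norm_eq_abs]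
  refine .of_lipschitz hlip (Eventually.of_forall fun t _ => ⟨e, h t, ?_⟩)
  simpa using (hasDerivAt_id t).smul_const e

theorem filippovMap_subset_singleton [NormedSpace ℝ E] [MeasureSpace E] {g : E → E} {x : E}
    (hg : ContinuousAt g x) : filippovMap g x ⊆ {g x} := fun _ hv =>
  clm_eq_of_mem_filippovMap (ContinuousLinearMap.id ℝ E) hg hv

/-- A solution does not reach in finite time an equilibrium near which the vector field grows at
most linearly. -/
theorem IsFilippovSolution.ne_of_norm_le [InnerProductSpace ℝ E] [FiniteDimensional ℝ E]
    [MeasureSpace E] {g : E → E} {J : Set ℝ} {x : ℝ → E} (hx : IsFilippovSolution g J x) {e : E}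
    {K : ℝ} (h : ∀ z, ∀ v ∈ filippovMap g z, ‖v‖ ≤ K * ‖z - e‖) (h0 : x 0 ≠ e) {T : ℝ}
    (hT : T ∈ J) : x T ≠ e := by
  intro hTe
  have hT0 := hx.nonneg T hT
  have hac1 : AbsolutelyContinuousOnInterval (fun t => x t - e) 0 T :=
    absolutelyContinuous_lipschitz_comp (φ := fun z => z - e)
      ((LipschitzWith.id.sub (LipschitzWith.const e)).lipschitzOnWith)
      (hx.absolutelyContinuous T hT)
  have hac2 := absolutelyContinuous_inner_clm (ContinuousLinearMap.id ℝ E) hac1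
  have hac3 : AbsolutelyContinuousOnInterval (fun t : ℝ => Real.exp (2 * K * t)) 0 T :=
    ContDiffOn.absolutelyContinuousOnInterval (by fun_prop)
  -- Grönwall backwards: ‖x t - e‖² exp(2Kt) is nondecreasing, so it cannot fall from a positive
  -- value to 0.
  have := sub_le_mul_of_ae_deriv_le (c := 0) hT0 (hac2.fun_mul hac3).fun_neg (by
    filter_upwards [hx.hasDerivAt] with t ht htab
    obtain ⟨v, hv, hd⟩ := ht (hx.mem_of_le htab.1.le htab.2.le hT)
    have h1 := hasDerivAt_inner_clm (ContinuousLinearMap.id ℝ E) (fun _ _ => rfl) (hd.sub_const e)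
    have h2 : HasDerivAt (fun t : ℝ => Real.exp (2 * K * t)) (Real.exp (2 * K * t) * (2 * K)) t := by
      simpa using ((hasDerivAt_id t).const_mul (2 * K)).exp
    refine ⟨_, ?_, (h1.mul h2).neg⟩
    have h3 : -(K * ‖x t - e‖ ^ 2) ≤ inner ℝ (x t - e) v := by
      have h4 := (abs_le.1 (abs_real_inner_le_norm (x t - e) v)).1
      have h5 := mul_le_mul_of_nonneg_left (h _ v hv) (norm_nonneg (x t - e))
      nlinarith
    simp only [ContinuousLinearMap.coe_id', id_eq, real_inner_self_eq_norm_sq]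
    have h6 := Real.exp_pos (2 * K * t)
    nlinarith)
  have h7 : 0 < ‖x 0 - e‖ := norm_pos_iff.2 (sub_ne_zero.2 h0)
  simp only [hTe, sub_self, ContinuousLinearMap.coe_id', id_eq, inner_zero_left, zero_mul,
    real_inner_self_eq_norm_sq, mul_zero, Real.exp_zero, mul_one, neg_zero, sub_neg_eq_add,
    zero_add] at this
  nlinarith

end General

/-! ### Velocities available to the closed loop -/

section Velocities

variable {n k : ℕ} {p : ℝ≥0∞} [Fact (1 ≤ p)] {G : SimpleGraph (Fin n)}
  {w : Fin n → Fin n → ℝ} {Ic : Finset (Fin n)}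
  {f : Fin n → EuclideanSpace ℝ (Fin k) → EuclideanSpace ℝ (Fin k)}

theorem tendsto_state {α : Type*} {l : Filter α} {u : α → State n k} {v : State n k}
    (h : ∀ i, Tendsto (fun a => u a i) l (𝓝 (v i))) : Tendsto u l (𝓝 v) :=
  ((PiLp.continuous_toLp 2 (fun _ : Fin n => EuclideanSpace ℝ (Fin k))).tendsto _).comp
    (tendsto_pi_nhds.2 h)

theorem IsAdmissible.continuousAt_closedLoop (hf : IsAdmissible p Ic f) {x : State n k}
    (h : ∀ i, i ∈ Ic ∨ lap (adjacency G w) x i ≠ 0) : ContinuousAt (closedLoop G w f) x :=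
  tendsto_state fun i =>
    continuousAt_closedLoop_apply (hf.continuousAt ((h i).imp_right neg_ne_zero.2))

/-- The velocities along a ray whose signum agents all see a nonzero disagreement. -/
theorem IsAdmissible.mem_filippovMap_of_direction (hf : IsAdmissible p Ic f) {x u v : State n k}
    (hx : ∀ i ∉ Ic, lap (adjacency G w) x i = 0) (hu : ∀ i ∉ Ic, lap (adjacency G w) u i ≠ 0)
    (hvc : ∀ i ∈ Ic, v i = f i (-lap (adjacency G w) x i))
    (hvs : ∀ i ∉ Ic, v i = dirSign p (-lap (adjacency G w) u i)) :
    v ∈ filippovMap (closedLoop G w f) x := by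
  have hlap : ∀ (ε : ℝ) i, lap (adjacency G w) (x + ε • u) i =
      lap (adjacency G w) x i + ε • lap (adjacency G w) u i := fun ε i => by simp
  have hlim : Tendsto (fun ε : ℝ => x + ε • u) (𝓝[>] 0) (𝓝 x) := by
    have : ContinuousAt (fun ε : ℝ => x + ε • u) 0 := by fun_prop
    simpa using this.tendsto.mono_left nhdsWithin_le_nhds
  refine mem_filippovMap_of_tendsto hlim ?_ (tendsto_state fun i => ?_)
  · filter_upwards [self_mem_nhdsWithin] with ε hε
    refine hf.continuousAt_closedLoop fun i => or_iff_not_imp_left.2 fun hi => ?_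
    rw [hlap, hx i hi, zero_add]
    exact smul_ne_zero (ne_of_gt hε) (hu i hi)
  · by_cases hi : i ∈ Ic
    · have := (continuousAt_closedLoop_apply (G := G) (w := w) (x := x) (f := f)
        (hf.continuousAt (Or.inl hi))).tendsto.comp hlim
      rw [hvc i hi, ← closedLoop_eq G w f]
      exact this
    -- The signum is invariant under positive scaling, so this block of the velocity is constant
    -- along the ray.
    · refine tendsto_const_nhds.congr' ?_
      filter_upwards [self_mem_nhdsWithin] with ε hε
      rw [closedLoop_eq, hlap, hx i hi, zero_add, ← smul_neg, hf.signum_agents i hi,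
        dirSign_smul p hε, hvs i hi]

theorem mem_convexHull_dirSign {v e₀ : EuclideanSpace ℝ (Fin k)} (he₀ : e₀ ≠ 0)
    (hv : ‖toLpEquiv p k v‖ ≤ 1) : v ∈ convexHull ℝ (dirSign p '' {0}ᶜ) := by
  obtain ⟨e, he, ρ, hρ0, hρ1, rfl⟩ : ∃ e : EuclideanSpace ℝ (Fin k), e ≠ 0 ∧
      ∃ ρ : ℝ, 0 ≤ ρ ∧ ρ ≤ 1 ∧ ρ • dirSign p e = v := by
    rcases eq_or_ne v 0 with rfl | hv0
    · exact ⟨e₀, he₀, 0, le_rfl, zero_le_one, zero_smul _ _⟩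
    · refine ⟨v, hv0, _, norm_nonneg _, hv, ?_⟩
      rw [dirSign_eq, smul_smul, mul_inv_cancel₀ (norm_toLpEquiv_pos p hv0).ne', one_smul]
  have h1 : dirSign p e ∈ convexHull ℝ (dirSign p '' {0}ᶜ) := subset_convexHull ℝ _ ⟨e, he, rfl⟩
  have h2 : -dirSign p e ∈ convexHull ℝ (dirSign p '' {0}ᶜ) :=
    subset_convexHull ℝ _ ⟨-e, neg_ne_zero.2 he, dirSign_neg p e⟩
  -- The weights (1 ± ρ)/2 on the unit vectors ± `dirSign p e` produce ρ times that vector.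
  have h3 := convex_convexHull ℝ _ h1 h2 (by linarith : 0 ≤ (1 + ρ) / 2)
    (by linarith : 0 ≤ (1 - ρ) / 2) (by ring)
  convert h3 using 1
  rw [smul_neg, ← sub_eq_add_neg, ← sub_smul]
  congr 1
  ring

/-- While the signum agents see no disagreement, they can move in any direction with at most unit
speed. -/
theorem IsAdmissible.mem_filippovMap (hf : IsAdmissible p Ic f) (hA : IsNetwork (adjacency G w))
    (hk : 1 ≤ k) (hne : Ic.Nonempty) {x v : State n k}
    (hx : ∀ i ∉ Ic, lap (adjacency G w) x i = 0)
    (hvc : ∀ i ∈ Ic, v i = f i (-lap (adjacency G w) x i))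
    (hvs : ∀ i ∉ Ic, ‖toLpEquiv p k (v i)‖ ≤ 1) : v ∈ filippovMap (closedLoop G w f) x := by
  classical
  obtain ⟨T, hT⟩ := hA.exists_mixedEquiv hne k
  let t : Fin n → Set (EuclideanSpace ℝ (Fin k)) := fun i =>
    if i ∈ Ic then {f i (-lap (adjacency G w) x i)} else dirSign p '' {0}ᶜ
  let Λ : (Fin n → EuclideanSpace ℝ (Fin k)) →ₗ[ℝ] State n k :=
    (WithLp.linearEquiv 2 ℝ (Fin n → EuclideanSpace ℝ (Fin k))).symm.toLinearMap
  -- The mixed parametrization yields a perturbation realizing any chosen nonzero disagreements at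
  -- all signum agents simultaneously, so their directions vary independently.
  have hsub : univ.pi t ⊆ Λ ⁻¹' filippovMap (closedLoop G w f) x := by
    intro d hd
    have hds : ∀ i, i ∉ Ic → ∃ e, e ≠ 0 ∧ dirSign p e = d i := fun i hi => by
      have := hd i (mem_univ i)
      simp only [t, if_neg hi] at this
      obtain ⟨e, he, hed⟩ := this
      exact ⟨e, he, hed⟩
    choose! e he hed using hds
    have hu : ∀ i ∉ Ic, lap (adjacency G w) (T.symm (WithLp.toLp 2 fun i => -e i)) i = -e i :=
      fun i hi => by
        have := hT (T.symm (WithLp.toLp 2 fun i => -e i)) i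
        rw [T.apply_symm_apply, if_neg hi] at this
        exact this.symm
    refine hf.mem_filippovMap_of_direction (u := T.symm (WithLp.toLp 2 fun i => -e i)) hx
      (fun i hi => ?_) (fun i hi => ?_) fun i hi => ?_
    · rw [hu i hi]
      exact neg_ne_zero.2 (he i hi)
    · have := hd i (mem_univ i)
      simp only [t, if_pos hi] at this
      exact this
    · rw [hu i hi, neg_neg, hed i hi]
      rfl
  have hmem : WithLp.ofLp v ∈ convexHull ℝ (univ.pi t) := by
    -- The hull of a product is the product of the hulls, which reduces the claim to one agent at a
    -- time.
    rw [convexHull_pi]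
    intro i _
    by_cases hi : i ∈ Ic
    · simp [t, if_pos hi, hvc i hi]
    · simp only [t, if_neg hi]
      refine mem_convexHull_dirSign (e₀ := EuclideanSpace.single ⟨0, hk⟩ (1 : ℝ)) ?_ (hvs i hi)
      simp
  exact convexHull_min hsub ((convex_filippovMap _ x).linear_preimage Λ) hmem

end Velocities

/-! ### Moving consensus -/

section Moving

variable {n k : ℕ} {p : ℝ≥0∞} [Fact (1 ≤ p)] {G : SimpleGraph (Fin n)}
  {w : Fin n → Fin n → ℝ} {f : Fin n → EuclideanSpace ℝ (Fin k) → EuclideanSpace ℝ (Fin k)}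

theorem IsAdmissible.consensus_mem_filippovMap (hf : IsAdmissible p ∅ f)
    (hA : IsNetwork (adjacency G w)) (hn : 2 < n) {e : EuclideanSpace ℝ (Fin k)} (he : e ≠ 0)
    (c : EuclideanSpace ℝ (Fin k)) :
    consensus n (((n : ℝ)⁻¹ * (n - 2)) • dirSign p e) ∈
      filippovMap (closedLoop G w f) (consensus n c) := by
  have hn0 : (0 : ℝ) < n := by positivity
  let v : Fin n → State n k := fun j =>
    WithLp.toLp 2 fun i => if i = j then -dirSign p e else dirSign p e
  have hv : ∀ j, v j ∈ filippovMap (closedLoop G w f) (consensus n c) := fun j => by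
    obtain ⟨T, hT⟩ := hA.exists_mixedEquiv (Finset.singleton_nonempty j) k
    -- All agents but `j` get disagreement -e; the zero sum then forces (n - 1)e at `j`. The
    -- position prescribed at `j` plays no role.
    set u := T.symm (consensus n (-e)) with hu
    have h1 : ∀ i, i ≠ j → lap (adjacency G w) u i = -e := fun i hi => by
      have := hT u i
      rw [hu, T.apply_symm_apply, if_neg (by simpa using hi)] at this
      exact this.symm
    have h2 : lap (adjacency G w) u j = ((n : ℝ) - 1) • e := by
      have h := hA.sum_lap u
      rw [← Finset.add_sum_erase _ _ (Finset.mem_univ j),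
        Finset.sum_congr rfl fun i hi => h1 i (Finset.ne_of_mem_erase hi), Finset.sum_const,
        Finset.card_erase_of_mem (Finset.mem_univ j), Finset.card_univ, Fintype.card_fin] at h
      rw [eq_neg_of_add_eq_zero_left h, smul_neg, neg_neg, ← Nat.cast_smul_eq_nsmul ℝ,
        Nat.cast_sub (by lia), Nat.cast_one]
    have hn1 : (0 : ℝ) < n - 1 := by
      have : (2 : ℝ) < n := by exact_mod_cast hn
      linarith
    refine hf.mem_filippovMap_of_direction (u := u) (fun i _ => by simp) (fun i _ => ?_)
      (fun i hi => by simp at hi) fun i _ => ?_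
    · rcases eq_or_ne i j with rfl | hij
      · rw [h2]
        exact smul_ne_zero hn1.ne' he
      · rw [h1 i hij]
        exact neg_ne_zero.2 he
    · rcases eq_or_ne i j with rfl | hij
      · rw [h2, dirSign_neg, dirSign_smul p hn1]
        simp [v]
      · rw [h1 i hij, neg_neg]
        simp [v, hij]
  -- In the average over `j`, each agent gets n - 1 times +s and once -s, with s = `dirSign p e`.
  have hmean := (convex_filippovMap (closedLoop G w f) (consensus n c)).sum_mem
    (t := Finset.univ) (w := fun _ : Fin n => (n : ℝ)⁻¹) (z := v) (fun _ _ => by positivity)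
    (by simp [hn0.ne']) fun j _ => hv j
  convert hmean using 1
  ext1 i
  have hsplit : ∀ j, (if i = j then -dirSign p e else dirSign p e) =
      dirSign p e - if i = j then (2 : ℝ) • dirSign p e else 0 := fun j => by
    split_ifs
    · rw [two_smul]
      abel
    · rw [sub_zero]
  rw [← Finset.smul_sum, PiLp.smul_apply, WithLp.ofLp_sum, Finset.sum_apply]
  simp only [v, hsplit, Finset.sum_sub_distrib, Finset.sum_const, Finset.sum_ite_eq,
    Finset.mem_univ, if_true, Finset.card_univ, Fintype.card_fin, consensus_apply]
  rw [← Nat.cast_smul_eq_nsmul ℝ, ← sub_smul, smul_smul]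

theorem IsAdmissible.not_finiteTimeStaticConsensus_of_empty (hf : IsAdmissible p ∅ f)
    (hA : IsNetwork (adjacency G w)) (hk : 1 ≤ k) (hn : 2 < n) :
    ¬ FiniteTimeStaticConsensus (closedLoop G w f) := by
  intro hcon
  have he : (EuclideanSpace.single ⟨0, hk⟩ 1 : EuclideanSpace ℝ (Fin k)) ≠ 0 := by simp
  set d := ((n : ℝ)⁻¹ * (n - 2)) • dirSign p
    (EuclideanSpace.single ⟨0, hk⟩ 1 : EuclideanSpace ℝ (Fin k)) with hd
  have hd0 : d ≠ 0 := by
    have hn' : (2 : ℝ) < n := by exact_mod_cast hn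
    have hpos : 0 < (n : ℝ)⁻¹ * (n - 2) := mul_pos (by positivity) (by linarith)
    exact smul_ne_zero hpos.ne' (dirSign_ne_zero p he)
  have hsol : IsFilippovSolution (closedLoop G w f) (Ici 0) fun t : ℝ => t • consensus n d :=
    isFilippovSolution_smul fun t => hf.consensus_mem_filippovMap hA hn he (t • d)
  obtain ⟨-, T, -, c, hc⟩ := hcon _ _ hsol.isMaximal_Ici
  have h1 := hc T le_rfl ⟨0, by lia⟩
  have h2 := hc (T + 1) (by linarith) ⟨0, by lia⟩
  simp only [PiLp.smul_apply, consensus_apply] at h1 h2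
  rw [add_smul, h1, one_smul, add_eq_left] at h2
  exact hd0 h2

end Moving

/-! ### At least two continuous agents -/

section Clip

variable {E : Type*} [NormedAddCommGroup E] [InnerProductSpace ℝ E]

/-- The radial retraction onto the closed ball of radius `r`. -/
noncomputable def clip (r : ℝ) (y : E) : E := (r / max r ‖y‖) • y

theorem continuous_clip {r : ℝ} (hr : 0 < r) : Continuous (clip r : E → E) :=
  (continuous_const.div (continuous_const.max continuous_norm) fun _ =>
    (lt_max_of_lt_left hr).ne').smul continuous_id

theorem clip_of_norm_le {r : ℝ} (hr : 0 < r) {y : E} (hy : ‖y‖ ≤ r) : clip r y = y := by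
  rw [clip, max_eq_left hy, div_self hr.ne', one_smul]

theorem norm_clip_le {r : ℝ} (hr : 0 < r) (y : E) : ‖clip r y‖ ≤ r := by
  have h : 0 < max r ‖y‖ := lt_max_of_lt_left hr
  rw [clip, norm_smul, Real.norm_of_nonneg (by positivity), div_mul_eq_mul_div, div_le_iff₀ h]
  gcongr
  exact le_max_right _ _

theorem norm_clip_le_norm {r : ℝ} (hr : 0 < r) (y : E) : ‖clip r y‖ ≤ ‖y‖ := by
  have h : 0 < max r ‖y‖ := lt_max_of_lt_left hr
  rw [clip, norm_smul, Real.norm_of_nonneg (by positivity), div_mul_eq_mul_div, div_le_iff₀ h,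
    mul_comm]
  gcongr
  exact le_max_left _ _

theorem inner_clip_nonneg {r : ℝ} (hr : 0 < r) {φ : E → E} (hφ : ∀ y, 0 ≤ inner ℝ (φ y) y)
    (y : E) : 0 ≤ inner ℝ (φ (clip r y)) y := by
  have h : 0 < max r ‖y‖ := lt_max_of_lt_left hr
  have h1 := hφ (clip r y)
  nth_rewrite 2 [clip] at h1
  rw [inner_smul_right] at h1
  exact nonneg_of_mul_nonneg_right h1 (by positivity)

end Clip

section Sliding

variable {n k : ℕ} {p : ℝ≥0∞} {G : SimpleGraph (Fin n)}
  {w : Fin n → Fin n → ℝ} {Ic : Finset (Fin n)}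
  {f : Fin n → EuclideanSpace ℝ (Fin k) → EuclideanSpace ℝ (Fin k)}

theorem IsDirectionPreserving.inner_nonneg {φ : EuclideanSpace ℝ (Fin k) → EuclideanSpace ℝ (Fin k)}
    (hφ : IsDirectionPreserving φ) (y : EuclideanSpace ℝ (Fin k)) : 0 ≤ inner ℝ (φ y) y := by
  rcases eq_or_ne y 0 with rfl | hy
  · simp
  · exact (hφ.inner_pos y hy).le

/-- This is local Lipschitz continuity at 0 together with `f i 0 = 0`. Summing the constants makes
the bound uniform over `Ic`. -/
theorem IsAdmissible.exists_linear_growth (hf : IsAdmissible p Ic f) :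
    ∃ K : ℝ, 0 ≤ K ∧ ∃ r : ℝ, 0 < r ∧ ∀ i ∈ Ic, ∀ y, ‖y‖ ≤ r → ‖f i y‖ ≤ K * ‖y‖ := by
  have h : ∀ i ∈ Ic, ∃ K : ℝ≥0, ∀ᶠ y in 𝓝 (0 : EuclideanSpace ℝ (Fin k)), ‖f i y‖ ≤ K * ‖y‖ := by
    intro i hi
    obtain ⟨K, s, hs, hK⟩ := (hf.continuous_agents i hi).locallyLipschitz 0
    refine ⟨K, ?_⟩
    filter_upwards [hs] with y hy
    have := hK.dist_le_mul y hy 0 (mem_of_mem_nhds hs)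
    rwa [(hf.continuous_agents i hi).map_zero, dist_zero_right, dist_zero_right] at this
  choose! K hK using h
  obtain ⟨r, hr, hball⟩ := Metric.eventually_nhds_iff_ball.1 ((eventually_all_finset Ic).2 hK)
  refine ⟨∑ i ∈ Ic, (K i : ℝ), by positivity, r / 2, by positivity, fun i hi y hy => ?_⟩
  refine (hball y (by simpa using hy.trans_lt (by linarith)) i hi).trans ?_
  gcongr
  exact Finset.single_le_sum (f := fun i => (K i : ℝ)) (fun i _ => NNReal.coe_nonneg _) hi

/-- The commands of the continuous agents, with clipped inputs. -/
noncomputable def clippedCommand (A : Matrix (Fin n) (Fin n) ℝ)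
    (f : Fin n → EuclideanSpace ℝ (Fin k) → EuclideanSpace ℝ (Fin k)) (Ic : Finset (Fin n)) (r : ℝ)
    (x : State n k) : State n k :=
  WithLp.toLp 2 fun i => if i ∈ Ic then f i (clip r (-lap A x i)) else 0

theorem clippedCommand_of_mem {A : Matrix (Fin n) (Fin n) ℝ} {r : ℝ} {i : Fin n} (hi : i ∈ Ic)
    (x : State n k) : clippedCommand A f Ic r x i = f i (clip r (-lap A x i)) := if_pos hi

theorem clippedCommand_of_notMem {A : Matrix (Fin n) (Fin n) ℝ} {r : ℝ} {i : Fin n} (hi : i ∉ Ic)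
    (x : State n k) : clippedCommand A f Ic r x i = 0 := if_neg hi

theorem IsAdmissible.continuous_clippedCommand (hf : IsAdmissible p Ic f)
    (A : Matrix (Fin n) (Fin n) ℝ) {r : ℝ} (hr : 0 < r) :
    Continuous (clippedCommand A f Ic r) := by
  refine continuous_iff_continuousAt.2 fun x => tendsto_state fun i => ?_
  by_cases hi : i ∈ Ic
  · simp only [clippedCommand_of_mem hi]
    exact ((hf.continuous_agents i hi).locallyLipschitz.continuous.comp
      ((continuous_clip hr).comp (((agent i).continuous.comp (lap A).continuous).neg))).tendsto x
  · simp only [clippedCommand_of_notMem hi]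
    exact tendsto_const_nhds

/-- The bound by `r` gives global existence and admissible signum speeds; the bound by ‖Lx‖ prevents
arrival at consensus in finite time. -/
theorem norm_clippedCommand_le {A : Matrix (Fin n) (Fin n) ℝ} {K r₀ r : ℝ} (hK : 0 ≤ K)
    (hr : 0 < r) (hr₀ : r ≤ r₀) (hf : ∀ i ∈ Ic, ∀ y, ‖y‖ ≤ r₀ → ‖f i y‖ ≤ K * ‖y‖)
    (x : State n k) :
    ‖clippedCommand A f Ic r x‖ ≤ n * K * r ∧ ‖clippedCommand A f Ic r x‖ ≤ n * K * ‖lap A x‖ := by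
  have hsum : ∀ B : ℝ, 0 ≤ B → (∀ i ∈ Ic, ‖clip r (-lap A x i)‖ ≤ B) →
      ‖clippedCommand A f Ic r x‖ ≤ n * K * B := fun B hB h => by
    refine (norm_le_sum_norm_apply _).trans ?_
    have : ∀ i ∈ Finset.univ, ‖clippedCommand A f Ic r x i‖ ≤ K * B := fun i _ => by
      by_cases hi : i ∈ Ic
      · rw [clippedCommand_of_mem hi]
        refine (hf i hi _ ((norm_clip_le hr _).trans hr₀)).trans ?_
        gcongr
        exact h i hi
      · rw [clippedCommand_of_notMem hi, norm_zero]
        positivity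
    refine (Finset.sum_le_card_nsmul _ _ _ this).trans_eq ?_
    rw [Finset.card_univ, Fintype.card_fin, nsmul_eq_mul, mul_assoc]
  refine ⟨hsum r hr.le fun i _ => norm_clip_le hr _, hsum _ (norm_nonneg _) fun i _ => ?_⟩
  refine (norm_clip_le_norm hr _).trans ?_
  rw [norm_neg]
  exact PiLp.norm_apply_le _ i

/-- Two agents of `C` can be given different positions while the agents outside `C` keep zero
disagreement. Scaling then makes the energy small. -/
theorem IsNetwork.exists_small_state {A : Matrix (Fin n) (Fin n) ℝ} (hA : IsNetwork A)
    (hk : 1 ≤ k) {C : Finset (Fin n)} (hC : 1 < C.card) {r : ℝ} (hr : 0 < r) :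
    ∃ x : State n k, (∀ i ∉ C, lap A x i = 0) ∧ (∀ c, x ≠ consensus n c) ∧
      (‖(lap A : State n k →L[ℝ] State n k)‖ + 1) * inner ℝ x (lap A x) ≤ r ^ 2 := by
  obtain ⟨a, ha, b, hb, hab⟩ := Finset.one_lt_card.1 hC
  obtain ⟨T, hT⟩ := hA.exists_mixedEquiv ⟨a, ha⟩ k
  set e : EuclideanSpace ℝ (Fin k) := EuclideanSpace.single ⟨0, hk⟩ 1 with he
  have he0 : e ≠ 0 := by simp [he]
  let d : State n k := WithLp.toLp 2 fun i => if i = a then e else 0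
  set u := T.symm d with hu
  have hui : ∀ i, (if i ∈ C then u i else lap A u i) = if i = a then e else 0 := fun i => by
    rw [← hT, hu, T.apply_symm_apply]
  set B := (‖(lap A : State n k →L[ℝ] State n k)‖ + 1) * inner ℝ u (lap A u) with hB
  have hB0 : 0 ≤ B := mul_nonneg (by positivity) (hA.inner_lap_nonneg u)
  -- Since s ≤ 1, the scaled quantity s²B is at most s(B + 1) ≤ r².
  set s := min 1 (r ^ 2 / (B + 1)) with hs
  have hs0 : 0 < s := lt_min one_pos (by positivity)
  refine ⟨s • u, fun i hi => ?_, fun c hc => ?_, ?_⟩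
  · have := hui i
    rw [if_neg hi, if_neg (by rintro rfl; exact hi ha)] at this
    rw [map_smul, PiLp.smul_apply, this, smul_zero]
  · have h1 := hui a
    have h2 := hui b
    rw [if_pos ha, if_pos rfl] at h1
    rw [if_pos hb, if_neg hab.symm] at h2
    have h3 : s • u a = c := by rw [← PiLp.smul_apply, hc, consensus_apply]
    have h4 : s • u b = c := by rw [← PiLp.smul_apply, hc, consensus_apply]
    rw [h1] at h3
    rw [h2, smul_zero, ← h3] at h4
    exact smul_ne_zero hs0.ne' he0 h4.symm
  · rw [map_smul, inner_smul_left, inner_smul_right, RCLike.conj_to_real]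
    have hs1 : s ≤ 1 := min_le_left _ _
    have hs2 : s * (B + 1) ≤ r ^ 2 :=
      (le_div_iff₀ (by positivity)).1 (min_le_right _ _)
    calc _ = s * (s * B) := by rw [hB]; ring
      _ ≤ 1 * (s * (B + 1)) := by gcongr; linarith
      _ ≤ r ^ 2 := by rwa [one_mul]

variable [Fact (1 ≤ p)]

theorem IsAdmissible.not_finiteTimeStaticConsensus_of_one_lt_card (hf : IsAdmissible p Ic f)
    (hA : IsNetwork (adjacency G w)) (hk : 1 ≤ k) (hcard : 1 < Ic.card) :
    ¬ FiniteTimeStaticConsensus (closedLoop G w f) := by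
  set A := adjacency G w with hAdef
  have hne : Ic.Nonempty := Finset.card_pos.1 (by lia)
  obtain ⟨T, hT⟩ := hA.exists_mixedEquiv hne k
  obtain ⟨K, hK, r₀, hr₀, hfK⟩ := hf.exists_linear_growth
  set τ := ‖T.symm.toContinuousLinearMap‖ with hτ
  set Λ := ‖(toLpEquiv p k).toContinuousLinearMap‖ with hΛ
  set B := Λ * (τ * (n * K)) with hB
  have hB0 : 0 ≤ B := by positivity
  -- Below, the ℓ_p speed of the signum agents is at most B r, so this choice makes it at most 1.
  set r := min r₀ (1 / (B + 1)) with hrdef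
  have hr : 0 < r := lt_min hr₀ (by positivity)
  have hBr : B * r ≤ 1 := by
    have : r * (B + 1) ≤ 1 := (le_div_iff₀ (by positivity)).1 (min_le_right _ _)
    nlinarith
  let q := clippedCommand A f Ic r
  have hq := norm_clippedCommand_le (A := A) hK hr (min_le_left _ _) hfK
  -- The sliding field: agents of `Ic` obey their clipped command, and the others move so that their
  -- disagreement stays constant.
  let g : State n k → State n k := fun x => T.symm (q x)
  have hgn : ∀ x, ‖g x‖ ≤ τ * ‖q x‖ := fun x => T.symm.toContinuousLinearMap.le_opNorm (q x)
  have hgr : ∀ x, ‖g x‖ ≤ τ * (n * K * r) := fun x =>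
    (hgn x).trans (mul_le_mul_of_nonneg_left (hq x).1 (norm_nonneg _))
  have hgl : ∀ x, ‖g x‖ ≤ τ * (n * K * ‖lap A x‖) := fun x =>
    (hgn x).trans (mul_le_mul_of_nonneg_left (hq x).2 (norm_nonneg _))
  have hgcont : Continuous g := T.symm.continuous.comp (hf.continuous_clippedCommand A hr)
  have hgF : ∀ x, filippovMap g x ⊆ {g x} := fun x =>
    filippovMap_subset_singleton hgcont.continuousAt
  have hTg : ∀ x i, (if i ∈ Ic then g x i else lap A (g x) i) = q x i := fun x i => by
    rw [← hT, T.apply_symm_apply]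
  have hgc : ∀ x, ∀ i ∈ Ic, g x i = f i (clip r (-lap A x i)) := fun x i hi => by
    have := hTg x i
    rwa [if_pos hi, clippedCommand_of_mem hi] at this
  have hgs : ∀ x, ∀ i ∉ Ic, lap A (g x) i = 0 := fun x i hi => by
    have := hTg x i
    rwa [if_neg hi, clippedCommand_of_notMem hi] at this
  obtain ⟨x₀, hx₀s, hx₀c, hx₀r⟩ := hA.exists_small_state hk hcard hr
  obtain ⟨X, hXlip, hX0, hXd⟩ := exists_lipschitz_filippov_solution hgr x₀
  have hXg : IsFilippovSolution g (Ici 0) X := .of_lipschitz hXlip hXd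
  have hXs : ∀ t, 0 ≤ t → ∀ i ∉ Ic, lap A (X t) i = 0 := fun t ht i hi => by
    have := hXg.clm_eq ((agent i).comp (lap A)) le_rfl ht ht fun s _ v hv => by
      rw [hgF _ hv]
      exact hgs _ i hi
    rw [ContinuousLinearMap.comp_apply, ContinuousLinearMap.comp_apply, hX0] at this
    exact this.trans (hx₀s i hi)
  -- The energy does not increase under `g` either. Starting from small energy, the inputs never
  -- exceed `r`, so the clipping is inactive along `X`.
  have hXr : ∀ t, 0 ≤ t → ‖lap A (X t)‖ ≤ r := fun t ht => by
    have h1 : inner ℝ (X t) (lap A (X t)) ≤ inner ℝ (X 0) (lap A (X 0)) := by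
      refine hXg.inner_clm_le hA.inner_lap_comm le_rfl ht ht fun s hs v hv => ?_
      rw [hgF _ hv, PiLp.inner_apply]
      refine Finset.sum_nonpos fun i _ => ?_
      by_cases hi : i ∈ Ic
      · have := inner_clip_nonneg hr (hf.continuous_agents i hi).inner_nonneg (-lap A (X s) i)
        rw [hgc _ i hi]
        rw [inner_neg_right, real_inner_comm] at this
        linarith
      · rw [hXs s hs.1.le i hi, inner_zero_left]
    refine le_of_sq_le_sq ?_ hr.le
    refine (hA.norm_lap_sq_le (X t)).trans (le_trans ?_ hx₀r)
    rw [← hX0]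
    gcongr
  have hsol : IsFilippovSolution (closedLoop G w f) (Ici 0) X := by
    refine hXg.of_subset fun t ht v hv => ?_
    rw [hgF _ hv]
    refine hf.mem_filippovMap hA hk hne (hXs t ht) (fun i hi => ?_) fun i _ => ?_
    · rw [hgc _ i hi, clip_of_norm_le hr]
      rw [norm_neg]
      exact (PiLp.norm_apply_le _ i).trans (hXr t ht)
    · calc ‖toLpEquiv p k (g (X t) i)‖ ≤ Λ * ‖g (X t) i‖ :=
            (toLpEquiv p k).toContinuousLinearMap.le_opNorm _
        _ ≤ Λ * (τ * (n * K * r)) := by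
            gcongr
            exact (PiLp.norm_apply_le _ i).trans (hgr _)
        _ = B * r := by rw [hB]; ring
        _ ≤ 1 := hBr
  intro hcon
  obtain ⟨-, t, ht, c, hc⟩ := hcon _ _ hsol.isMaximal_Ici
  have hXc : X t = consensus n c := by
    ext1 i
    exact hc t le_rfl i
  refine hXg.ne_of_norm_le (e := consensus n c)
    (K := τ * (n * K * ‖(lap A : State n k →L[ℝ] State n k)‖)) (fun z v hv => ?_)
    (by rw [hX0]; exact hx₀c c) (T := t) ht.le hXc
  rw [hgF _ hv]
  have h1 : ‖lap A z‖ ≤ ‖(lap A : State n k →L[ℝ] State n k)‖ * ‖z - consensus n c‖ := by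
    have := (lap A).le_opNorm (z - consensus n c)
    rwa [map_sub, lap_consensus, sub_zero] at this
  calc _ ≤ τ * (n * K * ‖lap A z‖) := hgl z
    _ ≤ τ * (n * K * (‖(lap A : State n k →L[ℝ] State n k)‖ * ‖z - consensus n c‖)) := by gcongr
    _ = _ := by ring

end Sliding

end FiniteTimeConsensus

theorem mainTheorem1 {n k : ℕ} (hk : 1 ≤ k)
    (G : SimpleGraph (Fin n)) (hG : G.Connected)
    (w : Fin n → Fin n → ℝ) (hw_symm : ∀ i j, w i j = w j i)
    (hw_pos : ∀ i j, G.Adj i j → 0 < w i j)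
    (p : ℝ≥0∞) (hp : 1 ≤ p)
    (Ic : Finset (Fin n))
    (f : Fin n → EuclideanSpace ℝ (Fin k) → EuclideanSpace ℝ (Fin k))
    (hf : FiniteTimeConsensus.IsAdmissible p Ic f) :
    (2 < n → (FiniteTimeConsensus.FiniteTimeStaticConsensus
      (FiniteTimeConsensus.closedLoop G w f) ↔ Ic.card = 1)) ∧
    (n = 2 → (FiniteTimeConsensus.FiniteTimeStaticConsensus
      (FiniteTimeConsensus.closedLoop G w f) ↔ Ic.card ≤ 1)) := by
  have : Fact (1 ≤ p) := ⟨hp⟩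
  have hA := FiniteTimeConsensus.isNetwork_adjacency hG hw_symm hw_pos
  have hmany : FiniteTimeConsensus.FiniteTimeStaticConsensus
      (FiniteTimeConsensus.closedLoop G w f) → Ic.card ≤ 1 := fun h => by
    by_contra hcard
    exact hf.not_finiteTimeStaticConsensus_of_one_lt_card hA hk (not_le.1 hcard) h
  refine ⟨fun hn => ⟨fun h => ?_, hf.finiteTimeStaticConsensus_of_card_eq_one hA⟩,
    fun hn => ⟨hmany, fun hcard => ?_⟩⟩
  · rcases (hmany h).lt_or_eq with h0 | h1
    · rw [Nat.lt_one_iff, Finset.card_eq_zero] at h0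
      subst h0
      exact absurd h (hf.not_finiteTimeStaticConsensus_of_empty hA hk hn)
    · exact h1
  · rcases hcard.lt_or_eq with h0 | h1
    · rw [Nat.lt_one_iff, Finset.card_eq_zero] at h0
      subst h0 hn
      exact hf.finiteTimeStaticConsensus_of_two hA
    · exact hf.finiteTimeStaticConsensus_of_card_eq_one hA h1
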